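/- Let $\Gamma$ be a countable discrete group with a proper length function $\ell:\Gamma\to\mathbb{N}=\{0,1,2,\dots\}$ (that is, $\ell(\gamma)=0$ iff $\gamma=1$, $\ell(\gamma^{-1})=\ell(\gamma)$, $\ell(\gamma_1\gamma_2)\le\ell(\gamma_1)+\ell(\gamma_2)$, and $B_k:=\{\gamma:\ell(\gamma)\le k\}$ is finite for every $k$). Let $(X,d)$ be a metric space of diameter at most $2$ with a Borel probability measure $\nu$, and let $\rho:\Gamma\curvearrowright X$ be an action by homeomorphisms. For $A\subseteq X$ put $B_k\cdot A=\bigcup_{\gamma\in B_k}\gamma\cdot A$. **Definitions.** For $t\ge1$ let $d_\Gamma^t$ be the largest metric on $X$ with $d_\Gamma^t\le t\,d$ and $d_\Gamma^t(x,\gamma x)\le\ell(\gamma)$ for all $x\in X$, $\gamma\in\Gamma$; the warped cone is the family $(X,d^t_\Gamma)_{t\ge 1}$. The unified warped cone is $\mathcal{O}_\Gamma X=X\times[1,\infty)$ with the metric $d_\Gamma((x_1,t_1),(x_2,t_2))=d_\Gamma^{\min\{t_1,t_2\}}(x_1,x_2)+|t_1-t_2|$ and the measure $\nu\times\lambda$,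 where $\lambda$ is Lebesgue measure. $L^2$-spaces are complex, $\chi_A$ denotes both a characteristic function and the operator of multiplication by it, $\|\cdot\|$ is the operator norm, and the distance between two sets is the infimum of the distances between their points ($\infty$ if one of them is empty). - $\rho$ is *asymptotically expanding* if there are functions $c:(0,\frac12]\to\mathbb{R}_{>0}$ and $k:(0,\frac12]\to\mathbb{N}$ such that $\nu(B_{k(\alpha)}\cdot A)>(1+c(\alpha))\,\nu(A)$ for every $\alpha\in(0,\frac12]$ and every measurable $A\subseteq X$ with $\alpha\le\nu(A)\le\frac12$. - $P_X$ is the orthogonal projection of $L^2(X,\nu)$ onto the constant functions, and the Druţu–Nowak projection $\mathfrak{G}=P_X\otimes\mathrm{Id}_{L^2([1,\infty))}$ is the orthogonal projection of $L^2(\mathcal{O}_\Gamma X,\nu\times\lambda)$ onto $\mathbb{C}\otimes L^2([1,\infty),\lambda)$. - A bounded operator $T$ on $L^2(X,\nu)$ is *$\rho$-quasi-local* if for every $\varepsilon>0$ there is $k\in\mathbb{N}$ such that $\|\chi_AT\chi_C\|<\varepsilon$ for all measurable $A,C\subseteq X$ with $\nu((B_k\cdot A)\cap C)=0$. It has *finite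 $\rho$-propagation* if there is $k\in\mathbb{N}$ such that $\chi_AT\chi_C=0$ for all such $A,C$. - A bounded operator $T$ on $L^2(\mathcal{O}_\Gamma X,\nu\times\lambda)$ is *quasi-local* if for every $\varepsilon>0$ there is $R>0$ such that $\|\chi_AT\chi_C\|<\varepsilon$ for all measurable $A,C\subseteq\mathcal{O}_\Gamma X$ with $d_\Gamma(A,C)>R$. It has *finite propagation* if there is $R>0$ such that $\chi_AT\chi_C=0$ for all such $A,C$. - A family $(T_t)_{t\ge1}$ of bounded operators on $L^2(X,\nu)$ is *uniformly quasi-local* on the warped cone if for every $\varepsilon>0$ there is $R>0$ such that $\|\chi_AT_t\chi_C\|<\varepsilon$ for all $t\ge1$ and all measurable $A,C\subseteq X$ with $d_\Gamma^t(A,C)>R$. **Theorem.** (I) If $\nu$ is Radon, then the following are equivalent: 1. $\rho$ is asymptotically expanding; 2. $P_X$ is $\rho$-quasi-local; 3. $\mathfrak{G}$ is quasi-local; 4. the constant family $(P_X)_{t\ge1}$ is uniformly quasi-local on the warped cone. (II) If $\rho$ is measure-class-preserving (it sends null sets to null sets), then the following are equivalent: 1. $\rho$ is asymptotically expanding; 2.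 $P_X$ is a norm limit of operators of finite $\rho$-propagation; 3. $\mathfrak{G}$ is a norm limit of operators of finite propagation. -/

import Mathlib

open MeasureTheory Set
open scoped Pointwise ENNReal

noncomputable section

namespace AsympExp

/-! ### Proper length functions, balls, and properties of the action -/

/-- A proper length function `ℓ : Γ → ℕ` on a group. -/
structure IsProperLength {Γ : Type*} [Group Γ] (ℓ : Γ → ℕ) : Prop where
  eq_zero_iff : ∀ γ, ℓ γ = 0 ↔ γ = 1
  inv : ∀ γ, ℓ γ⁻¹ = ℓ γ
  mul_le : ∀ γ₁ γ₂, ℓ (γ₁ * γ₂) ≤ ℓ γ₁ + ℓ γ₂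
  finite_ball : ∀ k : ℕ, {γ | ℓ γ ≤ k}.Finite

/-- `B_k · A`, the union of the translates `γ · A` with `ℓ γ ≤ k`. -/
def ballSMul {Γ X : Type*} [Group Γ] [MulAction Γ X] (ℓ : Γ → ℕ) (k : ℕ) (A : Set X) : Set X :=
  ⋃ γ ∈ {γ : Γ | ℓ γ ≤ k}, γ • A

/-- The action sends null sets to null sets. -/
def MeasureClassPreserving (Γ : Type*) {X : Type*} [Group Γ] [MulAction Γ X] [MeasurableSpace X]
    (ν : Measure X) : Prop :=
  ∀ (γ : Γ) (A : Set X), MeasurableSet A → ν A = 0 → ν (γ • A) = 0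

/-- Asymptotic expansion in measure. -/
def AsymptoticallyExpanding {Γ X : Type*} [Group Γ] [MulAction Γ X] [MeasurableSpace X]
    (ℓ : Γ → ℕ) (ν : Measure X) : Prop :=
  ∃ (c : Ioc (0 : ℝ) (1 / 2) → ℝ) (k : Ioc (0 : ℝ) (1 / 2) → ℕ), (∀ α, 0 < c α) ∧
    ∀ (α : Ioc (0 : ℝ) (1 / 2)) (A : Set X), MeasurableSet A →
      (α : ℝ) * ν.real univ ≤ ν.real A → ν.real A ≤ ν.real univ / 2 →
        (1 + c α) * ν.real A < ν.real (ballSMul ℓ (k α) A)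

/-! ### Operators on complex `L²`-spaces -/

/-- The complex Hilbert space `L²(Y, μ)`. -/
abbrev L2 {Y : Type*} [MeasurableSpace Y] (μ : Measure Y) : Type _ := Lp ℂ 2 μ

/-- Bounded linear operators on `L²(Y, μ)`, with the operator norm. -/
abbrev Op {Y : Type*} [MeasurableSpace Y] (μ : Measure Y) : Type _ := L2 μ →L[ℂ] L2 μ

/-- The operator on `L²(Y, μ)` of multiplication by the characteristic function of `A`. -/
def chi {Y : Type*} [MeasurableSpace Y] (μ : Measure Y) {A : Set Y} (hA : MeasurableSet A) :
    Op μ :=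
  LinearMap.mkContinuous
    { toFun := fun f => ((Lp.memLp f).indicator hA).toLp (A.indicator f)
      map_add' := fun f g => by
        rw [← MemLp.toLp_add, MemLp.toLp_eq_toLp_iff]
        filter_upwards [Lp.coeFn_add f g] with x hx
        by_cases h : x ∈ A
        · simpa [h] using hx
        · simp [h]
      map_smul' := fun c f => by
        rw [RingHom.id_apply, ← MemLp.toLp_const_smul, MemLp.toLp_eq_toLp_iff]
        filter_upwards [Lp.coeFn_smul c f] with x hx
        by_cases h : x ∈ A
        · simpa [h] using hx
        · simp [h] }
    1
    (fun f => by
      rw [one_mul]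
      refine Lp.norm_le_norm_of_ae_le ?_
      filter_upwards [((Lp.memLp f).indicator hA).coeFn_toLp] with x hx
      refine (congrArg norm hx).trans_le ?_
      exact norm_indicator_le_norm_self _ _)

theorem chi_apply_ae {Y : Type*} [MeasurableSpace Y] (μ : Measure Y) {A : Set Y}
    (hA : MeasurableSet A) (f : L2 μ) : chi μ hA f =ᵐ[μ] A.indicator f :=
  ((Lp.memLp f).indicator hA).coeFn_toLp

/-- The averaging projection `P_X`: the orthogonal projection of `L²(X, ν)` onto the
constant functions. -/
def averagingProjection {X : Type*} [MeasurableSpace X] (ν : Measure X) [IsProbabilityMeasure ν] :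
    Op ν :=
  (Submodule.span ℂ {(Lp.const 2 ν (1 : ℂ) : L2 ν)}).starProjection

/-- `T` is a limit in operator norm of operators satisfying `Q`. -/
def IsNormLimitOf {Y : Type*} [MeasurableSpace Y] {μ : Measure Y} (Q : Op μ → Prop)
    (T : Op μ) : Prop :=
  ∃ S : ℕ → Op μ, (∀ n, Q (S n)) ∧ Filter.Tendsto (fun n => ‖S n - T‖) Filter.atTop (nhds 0)

/-! ### Dynamical quasi-locality and propagation -/

/-- `ρ`-quasi-locality of an operator on `L²(X, ν)`. -/
def DynQuasiLocal {Γ X : Type*} [Group Γ] [MulAction Γ X] [MeasurableSpace X]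
    (ℓ : Γ → ℕ) {ν : Measure X} (T : Op ν) : Prop :=
  ∀ ε : ℝ, 0 < ε → ∃ k : ℕ, ∀ (A C : Set X) (hA : MeasurableSet A) (hC : MeasurableSet C),
    ν (ballSMul ℓ k A ∩ C) = 0 → ‖chi ν hA ∘L T ∘L chi ν hC‖ < ε

/-- Finiteness of the `ρ`-propagation of an operator on `L²(X, ν)`. -/
def DynFinitePropagation {Γ X : Type*} [Group Γ] [MulAction Γ X] [MeasurableSpace X]
    (ℓ : Γ → ℕ) {ν : Measure X} (T : Op ν) : Prop :=
  ∃ k : ℕ, ∀ (A C : Set X) (hA : MeasurableSet A) (hC : MeasurableSet C),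
    ν (ballSMul ℓ k A ∩ C) = 0 → chi ν hA ∘L T ∘L chi ν hC = 0

/-! ### Quasi-locality and propagation with respect to a distance function -/

/-- The distance between two sets with respect to `δ` (infinite if one of them is empty). -/
def setDist {Y : Type*} (δ : Y → Y → ℝ) (A C : Set Y) : ℝ≥0∞ :=
  ⨅ a ∈ A, ⨅ c ∈ C, ENNReal.ofReal (δ a c)

/-- Quasi-locality of an operator on `L²(Y, μ)`, where `Y` has the distance function `δ`. -/
def QuasiLocal {Y : Type*} [MeasurableSpace Y] {μ : Measure Y} (δ : Y → Y → ℝ) (T : Op μ) :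
    Prop :=
  ∀ ε : ℝ, 0 < ε → ∃ R : ℝ, 0 < R ∧
    ∀ (A C : Set Y) (hA : MeasurableSet A) (hC : MeasurableSet C),
      ENNReal.ofReal R < setDist δ A C → ‖chi μ hA ∘L T ∘L chi μ hC‖ < ε

/-- Finite propagation of an operator on `L²(Y, μ)`, where `Y` has the distance function `δ`. -/
def FinitePropagation {Y : Type*} [MeasurableSpace Y] {μ : Measure Y} (δ : Y → Y → ℝ)
    (T : Op μ) : Prop :=
  ∃ R : ℝ, 0 < R ∧ ∀ (A C : Set Y) (hA : MeasurableSet A) (hC : MeasurableSet C),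
    ENNReal.ofReal R < setDist δ A C → chi μ hA ∘L T ∘L chi μ hC = 0

/-! ### Warped cones -/

/-- `δ` is a metric on the set `X`. -/
structure IsMetric {X : Type*} (δ : X → X → ℝ) : Prop where
  nonneg : ∀ x y, 0 ≤ δ x y
  eq_zero_iff : ∀ x y, δ x y = 0 ↔ x = y
  symm : ∀ x y, δ x y = δ y x
  triangle : ∀ x y z, δ x z ≤ δ x y + δ y z

/-- The metrics on `X` that are at most `t * dist` and for which `γ` moves each point by at
most `ℓ γ`. -/
def warpedMetrics {Γ X : Type*} [Group Γ] [MetricSpace X] [MulAction Γ X] (ℓ : Γ → ℕ) (t : ℝ) :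
    Set (X → X → ℝ) :=
  {δ | IsMetric δ ∧ (∀ x y, δ x y ≤ t * dist x y) ∧ ∀ (γ : Γ) (x : X), δ x (γ • x) ≤ ℓ γ}

/-- The warped metric `d_Γ^t`, the largest element of `warpedMetrics ℓ t`
(see `isGreatest_warpedDist`). -/
def warpedDist {Γ X : Type*} [Group Γ] [MetricSpace X] [MulAction Γ X] (ℓ : Γ → ℕ) (t : ℝ)
    (x y : X) : ℝ :=
  sSup ((fun δ : X → X → ℝ => δ x y) '' warpedMetrics ℓ t)

theorem isGreatest_warpedDist {Γ X : Type*} [Group Γ] [MetricSpace X] [MulAction Γ X]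
    {ℓ : Γ → ℕ} (hℓ : IsProperLength ℓ) {t : ℝ} (ht : 0 < t) :
    IsGreatest (warpedMetrics (X := X) ℓ t) (warpedDist ℓ t) := by
  have hbdd : ∀ x y : X, BddAbove ((fun δ : X → X → ℝ => δ x y) '' warpedMetrics ℓ t) := by
    rintro x y
    refine ⟨t * dist x y, ?_⟩
    rintro _ ⟨δ, hδ, rfl⟩
    exact hδ.2.1 x y
  have hm : (fun x y : X => min (t * dist x y) 1) ∈ warpedMetrics (X := X) ℓ t := by
    refine ⟨⟨?_, ?_, ?_, ?_⟩, ?_, ?_⟩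
    · intro x y; positivity
    · intro x y
      constructor
      · intro h
        have h2 : t * dist x y = 0 := by
          rcases min_choice (t * dist x y) 1 with h' | h' <;> simp only [h'] at h
          · exact h
          · norm_num at h
        rcases mul_eq_zero.1 h2 with h3 | h3
        · exact absurd h3 ht.ne'
        · exact dist_eq_zero.1 h3
      · rintro rfl; simp
    · intro x y; simp only [dist_comm]
    · intro x y z
      have h1 : t * dist x z ≤ t * dist x y + t * dist y z := by
        rw [← mul_add]; exact mul_le_mul_of_nonneg_left (dist_triangle _ _ _) ht.le
      have h2 : 0 ≤ t * dist x y := by positivity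
      have h3 : 0 ≤ t * dist y z := by positivity
      rcases min_cases (t * dist x y) 1 with h | h <;>
        rcases min_cases (t * dist y z) 1 with h' | h' <;>
        rcases min_cases (t * dist x z) 1 with h'' | h'' <;> linarith
    · intro x y; exact min_le_left _ _
    · intro γ x
      by_cases h : γ = 1
      · subst h; simp
      · have h1 : 1 ≤ ℓ γ := Nat.one_le_iff_ne_zero.2 fun h0 => h ((hℓ.eq_zero_iff γ).1 h0)
        exact (min_le_right _ _).trans (by exact_mod_cast h1)
  have hle : ∀ δ ∈ warpedMetrics (X := X) ℓ t, ∀ x y, δ x y ≤ warpedDist ℓ t x y :=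
    fun δ hδ x y => le_csSup (hbdd x y) ⟨δ, hδ, rfl⟩
  have hub : ∀ (x y : X) (b : ℝ), (∀ δ ∈ warpedMetrics (X := X) ℓ t, δ x y ≤ b) →
      warpedDist ℓ t x y ≤ b := by
    intro x y b hb
    refine csSup_le ⟨_, _, hm, rfl⟩ ?_
    rintro _ ⟨δ, hδ, rfl⟩
    exact hb δ hδ
  refine ⟨⟨⟨?_, ?_, ?_, ?_⟩, ?_, ?_⟩, fun δ hδ x y => hle δ hδ x y⟩
  · intro x y; exact (hm.1.nonneg x y).trans (hle _ hm x y)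
  · intro x y
    constructor
    · intro h
      exact (hm.1.eq_zero_iff x y).1 (le_antisymm ((hle _ hm x y).trans h.le) (hm.1.nonneg x y))
    · rintro rfl
      refine le_antisymm (hub _ _ _ fun δ hδ => ((hδ.1.eq_zero_iff x x).2 rfl).le) ?_
      exact (hm.1.nonneg x x).trans (hle _ hm x x)
  · intro x y
    exact le_antisymm (hub _ _ _ fun δ hδ => (hδ.1.symm x y).trans_le (hle δ hδ y x))
      (hub _ _ _ fun δ hδ => (hδ.1.symm y x).trans_le (hle δ hδ x y))
  · intro x y z
    exact hub _ _ _ fun δ hδ =>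
      (hδ.1.triangle x y z).trans (add_le_add (hle δ hδ x y) (hle δ hδ y z))
  · intro x y; exact hub _ _ _ fun δ hδ => hδ.2.1 x y
  · intro γ x; exact hub _ _ _ fun δ hδ => hδ.2.2 γ x

/-- Uniform quasi-locality on the warped cone `{(X, d_Γ^t) : t ≥ 1}` of a family of operators. -/
def UniformlyQuasiLocal {Γ X : Type*} [Group Γ] [MetricSpace X] [MulAction Γ X]
    [MeasurableSpace X] (ℓ : Γ → ℕ) {ν : Measure X} (T : Ici (1 : ℝ) → Op ν) : Prop :=
  ∀ ε : ℝ, 0 < ε → ∃ R : ℝ, 0 < R ∧ ∀ (t : Ici (1 : ℝ)) (A C : Set X)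
    (hA : MeasurableSet A) (hC : MeasurableSet C),
      ENNReal.ofReal R < setDist (warpedDist ℓ (t : ℝ)) A C →
        ‖chi ν hA ∘L T t ∘L chi ν hC‖ < ε

/-- The underlying set `X × [1, ∞)` of the unified warped cone. -/
abbrev Cone (X : Type*) : Type _ := X × Ici (1 : ℝ)

/-- The metric `d_Γ` of the unified warped cone. -/
def coneDist {Γ X : Type*} [Group Γ] [MetricSpace X] [MulAction Γ X] (ℓ : Γ → ℕ)
    (p q : Cone X) : ℝ :=
  warpedDist ℓ (min (p.2 : ℝ) (q.2 : ℝ)) p.1 q.1 + |(p.2 : ℝ) - (q.2 : ℝ)|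

/-- Lebesgue measure on `[1, ∞)`. -/
def lebesgueRay : Measure (Ici (1 : ℝ)) := (volume : Measure ℝ).comap Subtype.val

instance sigmaFinite_lebesgueRay : SigmaFinite lebesgueRay := by
  refine ⟨⟨⟨fun n => Subtype.val ⁻¹' spanningSets (volume : Measure ℝ) n, fun _ => trivial,
    fun n => ?_, ?_⟩⟩⟩
  · rw [lebesgueRay, (MeasurableEmbedding.subtype_coe measurableSet_Ici).comap_apply]
    exact (measure_mono (image_preimage_subset _ _)).trans_lt (measure_spanningSets_lt_top _ n)
  · rw [← preimage_iUnion, iUnion_spanningSets, preimage_univ]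

/-- The product measure `ν × λ` on the unified warped cone. -/
def coneMeasure {X : Type*} [MeasurableSpace X] (ν : Measure X) : Measure (Cone X) :=
  ν.prod lebesgueRay

/-- The isometric embedding `g ↦ 1 ⊗ g` of `L²([1, ∞), λ)` into `L²(X × [1, ∞), ν × λ)`. -/
def oneTensor {X : Type*} [MeasurableSpace X] (ν : Measure X) [IsProbabilityMeasure ν] :
    L2 lebesgueRay →ₗᵢ[ℂ] L2 (coneMeasure ν) :=
  Lp.compMeasurePreservingₗᵢ ℂ Prod.snd (measurePreserving_snd (μ := ν) (ν := lebesgueRay))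

instance completeSpace_range_oneTensor {X : Type*} [MeasurableSpace X] (ν : Measure X)
    [IsProbabilityMeasure ν] : CompleteSpace (LinearMap.range (oneTensor ν).toLinearMap) :=
  (oneTensor ν).isometry.isUniformInducing.isComplete_range.completeSpace_coe

/-- The Druţu--Nowak projection `P_X ⊗ Id`: the orthogonal projection of
`L²(X × [1, ∞), ν × λ)` onto `ℂ ⊗ L²([1, ∞), λ)`. See `drutuNowak_tensor`. -/
def drutuNowak {X : Type*} [MeasurableSpace X] (ν : Measure X) [IsProbabilityMeasure ν] :
    Op (coneMeasure ν) :=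
  (LinearMap.range (oneTensor ν).toLinearMap).starProjection

theorem oneTensor_ae {X : Type*} [MeasurableSpace X] (ν : Measure X) [IsProbabilityMeasure ν]
    (g : L2 lebesgueRay) : oneTensor ν g =ᵐ[coneMeasure ν] fun p => g p.2 :=
  Lp.coeFn_compMeasurePreserving g (measurePreserving_snd (μ := ν) (ν := lebesgueRay))

theorem averagingProjection_apply {X : Type*} [MeasurableSpace X] (ν : Measure X)
    [IsProbabilityMeasure ν] (f : L2 ν) :
    averagingProjection ν f = Lp.const 2 ν (∫ x, f x ∂ν) := by
  have h1 : ‖(Lp.const 2 ν (1 : ℂ) : L2 ν)‖ = 1 := by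
    refine (Lp.norm_const (p := 2) (μ := ν) (c := (1 : ℂ)) (by norm_num)).trans ?_
    simp
  rw [averagingProjection, Submodule.starProjection_unit_singleton ℂ h1]
  have h2 : inner ℂ (Lp.const 2 ν (1 : ℂ) : L2 ν) f = ∫ x, f x ∂ν := by
    rw [L2.inner_def]
    simp
  rw [h2]
  refine Lp.ext ?_
  filter_upwards [Lp.coeFn_const (p := 2) (μ := ν) (c := (1 : ℂ)),
    Lp.coeFn_const (p := 2) (μ := ν) (c := ∫ x, f x ∂ν),
    Lp.coeFn_smul (∫ x, f x ∂ν) (Lp.const 2 ν (1 : ℂ) : L2 ν)] with x h3 h4 h5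
  rw [h5, h4, Pi.smul_apply, h3]
  simp

/-- On elementary tensors, `drutuNowak ν` is `P_X ⊗ Id`. -/
theorem drutuNowak_tensor {X : Type*} [MeasurableSpace X] (ν : Measure X)
    [IsProbabilityMeasure ν] (f : L2 ν) (g : L2 lebesgueRay) (F : L2 (coneMeasure ν))
    (hF : F =ᵐ[coneMeasure ν] fun p => f p.1 * g p.2) :
    drutuNowak ν F =ᵐ[coneMeasure ν] fun p => averagingProjection ν f p.1 * g p.2 := by
  set c : ℂ := ∫ x, f x ∂ν with hc
  have key : drutuNowak ν F = c • oneTensor ν g := by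
    refine Submodule.eq_starProjection_of_mem_of_inner_eq_zero
      (Submodule.smul_mem _ _ ⟨g, rfl⟩) ?_
    rintro _ ⟨h, rfl⟩
    have hf : Integrable (fun x => f x) ν := (Lp.memLp f).integrable (by norm_num)
    have e : inner ℂ (F - c • oneTensor ν g) (oneTensor ν h)
        = ∫ p : Cone X, (star (f p.1) - star c) * (star (g p.2) * h p.2)
            ∂(ν.prod lebesgueRay) := by
      rw [L2.inner_def]
      refine integral_congr_ae ?_
      filter_upwards [hF, oneTensor_ae ν g, oneTensor_ae ν h,
        Lp.coeFn_smul c (oneTensor ν g), Lp.coeFn_sub F (c • oneTensor ν g)] with p h1 h2 h3 h4 h5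
      rw [h5, Pi.sub_apply, h4, Pi.smul_apply, h1, h2, h3]
      simp
      ring
    refine e.trans ?_
    rw [integral_prod_mul (fun x => star (f x) - star c) (fun t => star (g t) * h t)]
    have z : ∫ x, (star (f x) - star c) ∂ν = 0 := by
      have : ∀ x, star (f x) - star c = (starRingEnd ℂ) (f x - c) := fun x => by simp
      simp_rw [this]
      rw [integral_conj, integral_sub hf (integrable_const _)]
      simp [hc]
    rw [z, zero_mul]
  rw [key, averagingProjection_apply]
  have hq : ∀ᵐ p ∂(coneMeasure ν), Lp.const 2 ν c p.1 = c :=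
    (Measure.quasiMeasurePreserving_fst (μ := ν) (ν := lebesgueRay)).ae
      (Lp.coeFn_const (p := 2) (μ := ν) (c := c))
  filter_upwards [oneTensor_ae ν g, Lp.coeFn_smul c (oneTensor ν g), hq] with p h1 h2 h3
  rw [h2, Pi.smul_apply, h1, h3, smul_eq_mul]

end AsympExp

end

namespace AsympExp

/-! ### Balls -/

section Balls

variable {Γ X : Type*} [Group Γ] [MulAction Γ X] {ℓ : Γ → ℕ}

/-! Part I rests on an exact computation: `χ_A P_X χ_C` is the rank-one operator `f ↦ ⟨1_C, f⟩ 1_A`,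
of norm `√(ν(A) ν(C))`. Quasi-locality of `P_X` therefore says that two separated sets cannot both
have large measure. Asymptotic expansion gives this by iteration: a set of measure at least `α`
grows past `1/2` in boundedly many steps, and, the length being symmetric, doubling the radius takes
it past `1 - α`. The Druţu–Nowak projection averages over each fibre `X × {t}`, so its corners are
bounded by those of `P_X` on the fibres. Conversely, sets in `X` lift to the slab over `[t, t + 1]`,
which transfers quasi-locality back to every level `t`.

To recover expansion from the warped metrics, suppose that `B_k · A` misses a large part of `X`. The
warped distance is at least an infimum over chains of moves and jumps, and as `t → ∞` a chain of
bounded cost has tiny moves, hence ends near the `B_k`-orbit of its start. After shrinking to closed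
sets with little loss of measure, `A` and the complement of `B_k · A` are thus at warped distance at
least `k + 1` for large `t`, which contradicts quasi-locality (`exists_setDist_warpedDist_gt`).

In Part II the projection must be built from operators of finite propagation. Expansion says nothing
uniform about very small sets, so a spectral gap on all of `X` may fail. Removing a maximal set with
small boundary leaves a domain `Y` of almost full measure on which all sets expand linearly
(`exists_expanding_domain`). Boundaries are measured by a measure `m` on edges `(x, γ⁻¹ x)` whose
two marginals are both bounded by a multiple of `ν` (`exists_edgeMeasure`), so that `D f (x, y) = f
x - f y` is bounded into `L²(m)`. Cheeger's argument turns expansion of `Y` into a Poincaré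
inequality (`poincare_real`). Then `D*D` has finite propagation and a gap above the constants on
`Y`, and the powers of `χ_Y - κ D*D` converge in norm to the projection onto those constants
(`exists_dynFinitePropagation_norm_sub_lt`), which up to a scalar is the corner of `P_X` on `Y`. The
same holds on the cone, with `m × λ` and the same constants in every fibre. In the other direction,
limits of finite-propagation operators are quasi-local, and the cycle of Part I applies. -/

theorem mem_ballSMul {k : ℕ} {A : Set X} {x : X} :
    x ∈ ballSMul ℓ k A ↔ ∃ γ : Γ, ℓ γ ≤ k ∧ ∃ a ∈ A, γ • a = x := by
  simp [ballSMul, mem_smul_set]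

theorem smul_mem_ballSMul {k : ℕ} {A : Set X} {x : X} (hx : x ∈ A) {γ : Γ} (hγ : ℓ γ ≤ k) :
    γ • x ∈ ballSMul ℓ k A :=
  mem_ballSMul.2 ⟨γ, hγ, x, hx, rfl⟩

theorem subset_ballSMul (hℓ : IsProperLength ℓ) (k : ℕ) (A : Set X) : A ⊆ ballSMul ℓ k A := by
  intro x hx
  have := smul_mem_ballSMul (ℓ := ℓ) (k := k) hx (γ := 1) (by simp [(hℓ.eq_zero_iff 1).2 rfl])
  simpa using this

theorem ballSMul_ballSMul_subset (hℓ : IsProperLength ℓ) (j k : ℕ) (A : Set X) :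
    ballSMul ℓ j (ballSMul ℓ k A) ⊆ ballSMul ℓ (j + k) A := by
  intro x hx
  obtain ⟨γ, hγ, y, hy, rfl⟩ := mem_ballSMul.1 hx
  obtain ⟨γ', hγ', a, ha, rfl⟩ := mem_ballSMul.1 hy
  rw [smul_smul]
  exact smul_mem_ballSMul ha ((hℓ.mul_le _ _).trans (add_le_add hγ hγ'))

theorem ballSMul_mono_radius {j k : ℕ} (h : j ≤ k) (A : Set X) :
    ballSMul ℓ j A ⊆ ballSMul ℓ k A := by
  intro x hx
  obtain ⟨γ, hγ, a, ha, rfl⟩ := mem_ballSMul.1 hx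
  exact smul_mem_ballSMul ha (hγ.trans h)

/-- Since length functions are symmetric, so is disjointness from a `k`-neighbourhood. -/
theorem disjoint_ballSMul_comm (hℓ : IsProperLength ℓ) {k : ℕ} {A C : Set X}
    (h : Disjoint (ballSMul ℓ k A) C) : Disjoint A (ballSMul ℓ k C) := by
  rw [Set.disjoint_left] at h ⊢
  intro x hx hx'
  obtain ⟨γ, hγ, c, hc, rfl⟩ := mem_ballSMul.1 hx'
  refine h (smul_mem_ballSMul hx (γ := γ⁻¹) (by rwa [hℓ.inv])) ?_
  simpa using hc

theorem measurableSet_ballSMul [MeasurableSpace X] [MeasurableConstSMul Γ X]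
    (hℓ : IsProperLength ℓ) (k : ℕ) {A : Set X} (hA : MeasurableSet A) :
    MeasurableSet (ballSMul ℓ k A) :=
  (hℓ.finite_ball k).measurableSet_biUnion fun γ _ => hA.const_smul γ

end Balls

/-! ### The warped metric as a chain metric -/

section Chains

variable {Γ X : Type*} [Group Γ] [MetricSpace X] [MulAction Γ X]

/-- `WarpChain ℓ x y s j`: one can go from `x` to `y` by moves in `X` of total length `s` and
jumps along `Γ` of total length `j`. -/
inductive WarpChain (ℓ : Γ → ℕ) (x : X) : X → ℝ → ℕ → Prop
  | refl : WarpChain ℓ x x 0 0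
  | move {y : X} {s : ℝ} {j : ℕ} (z : X) :
      WarpChain ℓ x y s j → WarpChain ℓ x z (s + dist y z) j
  | jump {y : X} {s : ℝ} {j : ℕ} (γ : Γ) :
      WarpChain ℓ x y s j → WarpChain ℓ x (γ • y) s (j + ℓ γ)

variable {ℓ : Γ → ℕ}

theorem WarpChain.nonneg {x y : X} {s : ℝ} {j : ℕ} (h : WarpChain ℓ x y s j) : 0 ≤ s := by
  induction h with
  | refl => exact le_rfl
  | move z _ ih => positivity
  | jump γ _ ih => exact ih

theorem WarpChain.trans {x y z : X} {s s' : ℝ} {j j' : ℕ} (h : WarpChain ℓ x y s j)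
    (h' : WarpChain ℓ y z s' j') : WarpChain ℓ x z (s + s') (j + j') := by
  induction h' with
  | refl => simpa using h
  | move z _ ih => rw [← add_assoc]; exact ih.move z
  | jump γ _ ih => rw [← add_assoc]; exact ih.jump γ

theorem WarpChain.of_dist (x y : X) : WarpChain ℓ x y (dist x y) 0 := by
  simpa using (WarpChain.refl (ℓ := ℓ) (x := x)).move y

theorem WarpChain.of_smul (x : X) (γ : Γ) : WarpChain ℓ x (γ • x) 0 (ℓ γ) := by
  simpa using (WarpChain.refl (ℓ := ℓ) (x := x)).jump γ

theorem WarpChain.symm (hℓ : IsProperLength ℓ) {x y : X} {s : ℝ} {j : ℕ}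
    (h : WarpChain ℓ x y s j) : WarpChain ℓ y x s j := by
  induction h with
  | refl => exact .refl
  | @move y s j z _ ih =>
    have := (WarpChain.of_dist (ℓ := ℓ) z y).trans ih
    rwa [zero_add, add_comm, dist_comm] at this
  | @jump y s j γ _ ih =>
    have := (WarpChain.of_smul (ℓ := ℓ) (γ • y) γ⁻¹).trans (z := x) (by simpa using ih)
    rwa [zero_add, add_comm, hℓ.inv] at this

/-- The chain pseudometric, equal to the warped metric. -/
noncomputable def chainDist (ℓ : Γ → ℕ) (t : ℝ) (x y : X) : ℝ :=
  sInf {r | ∃ s j, WarpChain ℓ x y s j ∧ r = t * s + j}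

theorem chainDist_le {t : ℝ} (ht : 0 ≤ t) {x y : X} {s : ℝ} {j : ℕ}
    (h : WarpChain ℓ x y s j) : chainDist ℓ t x y ≤ t * s + j := by
  refine csInf_le ⟨0, ?_⟩ ⟨s, j, h, rfl⟩
  rintro _ ⟨s, j, h, rfl⟩
  have := h.nonneg
  positivity

theorem exists_chain_of_chainDist_lt {t r : ℝ} {x y : X} (h : chainDist ℓ t x y < r) :
    ∃ s j, WarpChain ℓ x y s j ∧ t * s + j < r := by
  have hne : {r | ∃ s j, WarpChain ℓ x y s j ∧ r = t * s + j}.Nonempty :=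
    ⟨_, _, _, WarpChain.of_dist x y, rfl⟩
  obtain ⟨_, ⟨s, j, hc, rfl⟩, hr⟩ := exists_lt_of_csInf_lt hne h
  exact ⟨s, j, hc, hr⟩

theorem chainDist_triangle {t : ℝ} (ht : 0 ≤ t) (x y z : X) :
    chainDist ℓ t x z ≤ chainDist ℓ t x y + chainDist ℓ t y z := by
  refine le_of_forall_pos_le_add fun ε hε => ?_
  obtain ⟨s, j, h, hr⟩ := exists_chain_of_chainDist_lt
    (lt_add_of_pos_right (chainDist ℓ t x y) (half_pos hε))
  obtain ⟨s', j', h', hr'⟩ := exists_chain_of_chainDist_lt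
    (lt_add_of_pos_right (chainDist ℓ t y z) (half_pos hε))
  have := chainDist_le ht (h.trans h')
  push_cast at this
  linarith

theorem chainDist_comm (hℓ : IsProperLength ℓ) (t : ℝ) (x y : X) :
    chainDist ℓ t x y = chainDist ℓ t y x := by
  unfold chainDist
  congr 1
  ext r
  exact ⟨fun ⟨s, j, h, e⟩ => ⟨s, j, h.symm hℓ, e⟩, fun ⟨s, j, h, e⟩ => ⟨s, j, h.symm hℓ, e⟩⟩

/-- Maximality of the warped metric gives this at once, provided the chain distance is compared
through an honest metric. -/
theorem chainDist_le_warpedDist (hℓ : IsProperLength ℓ) {t : ℝ} (ht : 0 < t) (x y : X) :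
    chainDist ℓ t x y ≤ warpedDist ℓ t x y := by
  obtain ⟨⟨hm, hd, hg⟩, hub⟩ := isGreatest_warpedDist (X := X) hℓ ht
  have hself : ∀ x : X, chainDist ℓ t x x ≤ 0 := fun x => by
    simpa using chainDist_le ht.le (WarpChain.refl (ℓ := ℓ) (x := x))
  -- Taking the maximum with the warped metric supplies definiteness, so the chain distance need
  -- only be a pseudometric.
  have key : (fun x y : X => max (chainDist ℓ t x y) (warpedDist ℓ t x y)) ∈
      warpedMetrics (X := X) ℓ t := by
    refine ⟨⟨fun x y => le_max_of_le_right (hm.nonneg x y), fun x y => ⟨fun h => ?_, ?_⟩,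
      fun x y => ?_, fun x y z => ?_⟩, fun x y => max_le ?_ (hd x y),
      fun γ x => max_le ?_ (hg γ x)⟩
    · exact (hm.eq_zero_iff x y).1 (le_antisymm (h ▸ le_max_right _ _) (hm.nonneg x y))
    · rintro rfl
      rw [(hm.eq_zero_iff x x).2 rfl, max_eq_right (hself x)]
    · rw [chainDist_comm hℓ, hm.symm]
    · exact max_le ((chainDist_triangle ht.le x y z).trans
          (add_le_add (le_max_left _ _) (le_max_left _ _)))
        ((hm.triangle x y z).trans (add_le_add (le_max_right _ _) (le_max_right _ _)))
    · simpa using chainDist_le ht.le (WarpChain.of_dist (ℓ := ℓ) x y)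
    · simpa using chainDist_le ht.le (WarpChain.of_smul (ℓ := ℓ) x γ)
  exact (le_max_left _ _).trans (hub key x y)

theorem exists_chain_of_warpedDist_lt (hℓ : IsProperLength ℓ) {t r : ℝ} (ht : 0 < t) {x y : X}
    (h : warpedDist ℓ t x y < r) : ∃ s j, WarpChain ℓ x y s j ∧ t * s + j < r :=
  exists_chain_of_chainDist_lt ((chainDist_le_warpedDist hℓ ht x y).trans_lt h)

theorem warpedDist_mono (hℓ : IsProperLength ℓ) {t t' : ℝ} (ht : 0 < t) (h : t ≤ t') (x y : X) :
    warpedDist ℓ t x y ≤ warpedDist ℓ t' x y := by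
  obtain ⟨hm, hd, hg⟩ := (isGreatest_warpedDist (X := X) hℓ ht).1
  exact (isGreatest_warpedDist (X := X) hℓ (ht.trans_le h)).2
    ⟨hm, fun x y => (hd x y).trans (mul_le_mul_of_nonneg_right h dist_nonneg), hg⟩ x y

theorem continuous_warpedDist_left (hℓ : IsProperLength ℓ) {t : ℝ} (ht : 0 < t) (y : X) :
    Continuous fun x => warpedDist ℓ t x y := by
  obtain ⟨hm, hd, -⟩ := (isGreatest_warpedDist (X := X) hℓ ht).1
  refine (LipschitzWith.of_dist_le_mul (K := ⟨t, ht.le⟩) fun x z => ?_).continuous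
  have h1 := hm.triangle x z y
  have h2 := hm.triangle z x y
  have h3 := hm.symm x z
  have h4 := hd x z
  rw [Real.dist_eq, abs_le]
  change -(t * dist x z) ≤ _ ∧ _ ≤ t * dist x z
  constructor <;> linarith

/-- Chains with short moves end close to the orbit of their starting point. -/
theorem WarpChain.exists_dist_lt [ContinuousConstSMul Γ X] (hℓ : IsProperLength ℓ) (x : X)
    (k : ℕ) : ∀ η : ℝ, 0 < η → ∃ δ : ℝ, 0 < δ ∧ ∀ (y : X) (s : ℝ) (j : ℕ),
      WarpChain ℓ x y s j → s ≤ δ → j ≤ k → ∃ γ : Γ, ℓ γ ≤ j ∧ dist y (γ • x) < η := by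
  have trivial_jump : ∀ γ : Γ, ℓ γ = 0 → γ = 1 := fun γ => (hℓ.eq_zero_iff γ).1
  induction k with
  | zero =>
    intro η hη
    refine ⟨η / 2, half_pos hη, fun y s j h hs hj => ?_⟩
    suffices H : j ≤ 0 → dist y x ≤ s by
      refine ⟨1, by simp [(hℓ.eq_zero_iff 1).2 rfl], ?_⟩
      rw [one_smul]
      linarith [H hj]
    clear hj hs
    induction h with
    | refl => simp
    | @move y s j z _ ih =>
      intro hj
      linarith [ih hj, dist_triangle z y x, dist_comm y z]
    | @jump y s j γ _ ih =>
      intro hj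
      rw [trivial_jump γ (by omega), one_smul]
      exact ih (by omega)
  | succ k ihk =>
    intro η hη
    -- Continuity of finitely many homeomorphisms at finitely many orbit points gives one `η'` for
    -- all of them.
    have h1 : ∀ᶠ η' in nhdsWithin (0 : ℝ) (Ioi 0), ∀ γ ∈ {γ : Γ | ℓ γ ≤ k + 1},
        ∀ γ' ∈ {γ : Γ | ℓ γ ≤ k + 1}, ∀ z : X, dist z (γ • x) < η' →
          dist (γ' • z) (γ' • γ • x) < η / 2 := by
      refine ((hℓ.finite_ball (k + 1)).eventually_all).2 fun γ _ =>
        ((hℓ.finite_ball (k + 1)).eventually_all).2 fun γ' _ => ?_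
      obtain ⟨e, he, H⟩ := Metric.continuous_iff.1 (continuous_const_smul γ') (γ • x) (η / 2)
        (half_pos hη)
      filter_upwards [Ioo_mem_nhdsGT he] with e' he' z hz
      exact H z (hz.trans he'.2)
    obtain ⟨η', hη'pos, hη'⟩ := (eventually_mem_nhdsWithin.and h1).exists
    obtain ⟨δ, hδ, H⟩ := ihk η' hη'pos
    refine ⟨min δ (η / 2), lt_min hδ (half_pos hη), fun y s j h hs hj => ?_⟩
    -- The error `η / 2 + s` suits the induction along the chain: moves are paid for by `s`, and
    -- each nontrivial jump resets the error to `η / 2`, because the chain before it has jump length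
    -- at most `k`.
    suffices H' : s ≤ δ → j ≤ k + 1 → ∃ γ : Γ, ℓ γ ≤ j ∧ dist y (γ • x) < η / 2 + s by
      obtain ⟨γ, hγ, h2⟩ := H' (hs.trans (min_le_left _ _)) hj
      exact ⟨γ, hγ, by linarith [hs.trans (min_le_right _ _)]⟩
    clear hs hj
    induction h with
    | refl => exact fun _ _ => ⟨1, by simp [(hℓ.eq_zero_iff 1).2 rfl], by simpa using hη⟩
    | @move y s j z _ ih =>
      intro hs hj
      obtain ⟨γ, hγ, h2⟩ := ih (by linarith [dist_nonneg (x := y) (y := z)]) hj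
      exact ⟨γ, hγ, by linarith [dist_triangle z y (γ • x), dist_comm y z]⟩
    | @jump y s j γ' hc ih =>
      intro hs hj
      rcases Nat.eq_zero_or_pos (ℓ γ') with h0 | h0
      · obtain ⟨γ, hγ, h2⟩ := ih hs (by omega)
        exact ⟨γ, by omega, by rwa [trivial_jump γ' h0, one_smul]⟩
      · obtain ⟨γ, hγ, h2⟩ := H y s j hc hs (by omega)
        refine ⟨γ' * γ, (hℓ.mul_le _ _).trans (by omega), ?_⟩
        rw [mul_smul]
        have := hη' γ (show ℓ γ ≤ k + 1 by omega) γ' (show ℓ γ' ≤ k + 1 by omega) y h2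
        linarith [hc.nonneg]

/-- If the closed set `F` misses the `k`-ball of the orbit of `x`, then its warped distance
from `x` is eventually at least `k + 1`. -/
theorem exists_forall_le_warpedDist [ContinuousConstSMul Γ X] (hℓ : IsProperLength ℓ) (x : X)
    (k : ℕ) {F : Set X} (hF : IsClosed F) (hx : ∀ γ : Γ, ℓ γ ≤ k → γ • x ∉ F) :
    ∃ T : ℝ, 1 ≤ T ∧ ∀ y ∈ F, (k : ℝ) + 1 ≤ warpedDist ℓ T x y := by
  have h1 : ∀ᶠ η in nhdsWithin (0 : ℝ) (Ioi 0), ∀ γ ∈ {γ : Γ | ℓ γ ≤ k},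
      ∀ y : X, dist y (γ • x) < η → y ∉ F := by
    refine ((hℓ.finite_ball k).eventually_all).2 fun γ hγ => ?_
    obtain ⟨e, he, H⟩ := Metric.isOpen_iff.1 hF.isOpen_compl (γ • x) (hx γ hγ)
    filter_upwards [Ioo_mem_nhdsGT he] with e' he' z hz
    exact H (Metric.mem_ball.2 (hz.trans he'.2))
  obtain ⟨η, hηpos, hη⟩ := (eventually_mem_nhdsWithin.and h1).exists
  obtain ⟨δ, hδ, H⟩ := WarpChain.exists_dist_lt hℓ x k η hηpos
  -- With this `T`, a chain of cost `T s + j < k + 1` has `s < δ`, and `j ≤ k` because `j` is an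
  -- integer.
  have hT : 0 < max 1 ((k + 1) / δ) := lt_max_of_lt_left one_pos
  refine ⟨max 1 ((k + 1) / δ), le_max_left _ _, fun y hy => ?_⟩
  by_contra! hlt
  obtain ⟨s, j, hc, hr⟩ := exists_chain_of_warpedDist_lt hℓ hT hlt
  have hs0 := hc.nonneg
  have hj : j ≤ k := by
    have : (j : ℝ) < k + 1 := by nlinarith
    exact_mod_cast Nat.lt_succ_iff.1 (by exact_mod_cast this)
  have hs : s ≤ δ := by
    have h3 : (k + 1) / δ * s ≤ max 1 ((k + 1) / δ) * s :=
      mul_le_mul_of_nonneg_right (le_max_right _ _) hs0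
    have h4 : (k + 1) / δ * s < k + 1 := by
      have : (0 : ℝ) ≤ j := by positivity
      linarith
    have h5 : (k + 1 : ℝ) / δ * s = (k + 1) * (s / δ) := by ring
    rw [h5] at h4
    have h6 : s / δ < 1 := by
      by_contra! h
      have : (0 : ℝ) < k + 1 := by positivity
      nlinarith
    exact ((div_lt_one hδ).1 h6).le
  obtain ⟨γ, hγ, hd⟩ := H y s j hc hs hj
  exact hη γ (show ℓ γ ≤ k by omega) y hd hy

end Chains

/-- The distance between sets is bounded below by a bound for the distances between points. -/
theorem le_setDist {Y : Type*} {δ : Y → Y → ℝ} {A C : Set Y} {r : ℝ}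
    (h : ∀ a ∈ A, ∀ c ∈ C, r ≤ δ a c) : ENNReal.ofReal r ≤ setDist δ A C :=
  le_iInf₂ fun a ha => le_iInf₂ fun c hc => ENNReal.ofReal_le_ofReal (h a ha c hc)

theorem lt_of_lt_setDist {Y : Type*} {δ : Y → Y → ℝ} {A C : Set Y} {r : ℝ}
    (h : ENNReal.ofReal r < setDist δ A C) {a c : Y} (ha : a ∈ A) (hc : c ∈ C) : r < δ a c := by
  by_contra! hle
  refine absurd h (not_lt.2 ?_)
  exact (iInf₂_le_of_le a ha (iInf₂_le c hc)).trans (ENNReal.ofReal_le_ofReal hle)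

/-- Disjointness from a `k`-neighbourhood is detected, up to small measure, by the warped
metrics. -/
theorem exists_setDist_warpedDist_gt {Γ X : Type*} [Group Γ] [MetricSpace X] [MulAction Γ X]
    {ℓ : Γ → ℕ} [ContinuousConstSMul Γ X] [MeasurableSpace X] [BorelSpace X]
    (hℓ : IsProperLength ℓ) (ν : Measure X) [IsFiniteMeasure ν] {A C : Set X}
    (hA : MeasurableSet A) (hC : MeasurableSet C) {k : ℕ} (hAC : Disjoint (ballSMul ℓ k A) C)
    {a c : ℝ} (ha : a < ν.real A) (ha0 : 0 ≤ a) (hc : c < ν.real C) (hc0 : 0 ≤ c) :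
    ∃ T : ℝ, 1 ≤ T ∧ ∃ A' C' : Set X, MeasurableSet A' ∧ MeasurableSet C' ∧ a < ν.real A' ∧
      c < ν.real C' ∧ ENNReal.ofReal (k + 1) ≤ setDist (warpedDist ℓ T) A' C' := by
  have hlt : ∀ {B : Set X} {b : ℝ}, 0 ≤ b → (b < ν.real B ↔ ENNReal.ofReal b < ν B) :=
    fun hb => by
      rw [Measure.real, ENNReal.ofReal_lt_iff_lt_toReal hb (measure_ne_top _ _)]
  -- Finite Borel measures on metric spaces are inner regular for closed sets. Closedness of `F'`
  -- separates each point of `F` from it at some finite level.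
  obtain ⟨F, hFA, hF, haF⟩ := hA.exists_lt_isClosed_of_ne_top (measure_ne_top ν A)
    ((hlt ha0).1 ha)
  obtain ⟨F', hFC, hF', hcF⟩ := hC.exists_lt_isClosed_of_ne_top (measure_ne_top ν C)
    ((hlt hc0).1 hc)
  -- The level needed depends on the point; the `E n` collect the points for which level `n + 1`
  -- suffices. They increase to `F`, so one of them has measure above `a`.
  let E : ℕ → Set X := fun n => {x ∈ F | ∀ y ∈ F', (k : ℝ) + 1 ≤ warpedDist ℓ (n + 1 : ℝ) x y}
  have hEclosed : ∀ n, IsClosed (E n) := fun n => by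
    have : E n = F ∩ ⋂ y ∈ F', {x | (k : ℝ) + 1 ≤ warpedDist ℓ (n + 1 : ℝ) x y} := by
      ext x; simp [E]
    rw [this]
    exact hF.inter (isClosed_biInter fun y _ =>
      isClosed_le continuous_const (continuous_warpedDist_left hℓ (by positivity) y))
  have hEmono : Monotone E := fun m n hmn x hx => ⟨hx.1, fun y hy => (hx.2 y hy).trans
    (warpedDist_mono hℓ (by positivity) (by gcongr) x y)⟩
  have hEunion : ⋃ n, E n = F := by
    refine subset_antisymm (iUnion_subset fun n x hx => hx.1) fun x hx => ?_
    obtain ⟨T, hT1, hT⟩ := exists_forall_le_warpedDist hℓ x k hF' fun γ hγ hmem =>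
      Set.disjoint_left.1 hAC (smul_mem_ballSMul (hFA hx) hγ) (hFC hmem)
    obtain ⟨n, hn⟩ := exists_nat_ge T
    exact mem_iUnion.2 ⟨n, hx, fun y hy => (hT y hy).trans
      (warpedDist_mono hℓ (by linarith) (by linarith) x y)⟩
  have hlim := tendsto_measure_iUnion_atTop (μ := ν) hEmono
  rw [hEunion] at hlim
  obtain ⟨n, hn⟩ := (hlim.eventually_const_lt haF).exists
  exact ⟨n + 1, by simp, E n, F', (hEclosed n).measurableSet, hF'.measurableSet, (hlt ha0).2 hn,
    (hlt hc0).2 hcF, le_setDist fun x hx y hy => hx.2 y hy⟩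

/-! ### Corners of the averaging projection, and quasi-locality -/

section Averaging

variable {X : Type*} [MeasurableSpace X] (ν : Measure X) [IsProbabilityMeasure ν]

theorem norm_indicatorConstLp_two {Y : Type*} [MeasurableSpace Y] (μ : Measure Y) {A : Set Y}
    (hA : MeasurableSet A) (hμA : μ A ≠ ∞) (c : ℂ) :
    ‖indicatorConstLp 2 hA hμA c‖ = ‖c‖ * √(μ.real A) := by
  rw [norm_indicatorConstLp (by norm_num) (by norm_num), Real.sqrt_eq_rpow]
  norm_num

theorem chi_averagingProjection_chi_apply {A C : Set X} (hA : MeasurableSet A)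
    (hC : MeasurableSet C) (f : L2 ν) :
    (chi ν hA ∘L averagingProjection ν ∘L chi ν hC) f =
      indicatorConstLp 2 hA (measure_ne_top ν A) (∫ x in C, f x ∂ν) := by
  have h1 : ∫ x, chi ν hC f x ∂ν = ∫ x in C, f x ∂ν := by
    rw [integral_congr_ae (chi_apply_ae ν hC f), integral_indicator hC]
  simp only [ContinuousLinearMap.comp_apply]
  rw [averagingProjection_apply, h1]
  refine Lp.ext ?_
  filter_upwards [chi_apply_ae ν hA (Lp.const 2 ν (∫ x in C, f x ∂ν)),
    indicatorConstLp_coeFn (p := 2) (hs := hA) (hμs := measure_ne_top ν A)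
      (c := ∫ x in C, f x ∂ν)] with x h2 h4
  rw [h2, h4]
  by_cases h : x ∈ A <;> simp [h]

/-- The corner is the rank-one operator `f ↦ ⟨1_C, f⟩ 1_A`: Cauchy–Schwarz bounds it, and `1_C`
attains the bound. Every statement on `P_X` thereby becomes one on measures of pairs of sets. -/
theorem norm_chi_averagingProjection_chi {A C : Set X} (hA : MeasurableSet A)
    (hC : MeasurableSet C) :
    ‖chi ν hA ∘L averagingProjection ν ∘L chi ν hC‖ = √(ν.real A) * √(ν.real C) := by
  refine le_antisymm (ContinuousLinearMap.opNorm_le_bound _ (by positivity) fun f => ?_) ?_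
  · rw [chi_averagingProjection_chi_apply, norm_indicatorConstLp_two,
      ← L2.inner_indicatorConstLp_one (𝕜 := ℂ) hC (measure_ne_top ν C) f]
    have h := norm_inner_le_norm (𝕜 := ℂ)
      (indicatorConstLp 2 hC (measure_ne_top ν C) (1 : ℂ)) f
    rw [norm_indicatorConstLp_two, norm_one, one_mul] at h
    calc _ ≤ √(ν.real C) * ‖f‖ * √(ν.real A) := by gcongr
      _ = _ := by ring
  · rcases eq_or_ne (ν.real C) 0 with h0 | h0
    · simp [h0]
    · have hpos : 0 < √(ν.real C) := Real.sqrt_pos.2 (lt_of_le_of_ne measureReal_nonneg h0.symm)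
      have h := (chi ν hA ∘L averagingProjection ν ∘L chi ν hC).le_opNorm
        (indicatorConstLp 2 hC (measure_ne_top ν C) (1 : ℂ))
      rw [chi_averagingProjection_chi_apply, norm_indicatorConstLp_two, norm_indicatorConstLp_two,
        setIntegral_indicatorConstLp hC, inter_self, norm_one, one_mul] at h
      have h2 : ‖ν.real C • (1 : ℂ)‖ = √(ν.real C) * √(ν.real C) := by
        rw [Real.mul_self_sqrt measureReal_nonneg]; simp
      rw [h2] at h
      refine le_of_mul_le_mul_right ?_ hpos
      linarith

end Averaging

/-! ### Growth of neighbourhoods under asymptotic expansion, and its equivalence with quasi-locality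
-/

section Expansion

variable {Γ X : Type*} [Group Γ] [MulAction Γ X] [MeasurableSpace X] [MeasurableConstSMul Γ X]
  {ℓ : Γ → ℕ} (hℓ : IsProperLength ℓ) {ν : Measure X} [IsProbabilityMeasure ν]

include hℓ

/-- Under asymptotic expansion, sets of measure at least `α` have neighbourhoods of measure
larger than `1 / 2`, of uniform radius. -/
theorem AsymptoticallyExpanding.exists_half_lt (h : AsymptoticallyExpanding ℓ ν) {α : ℝ}
    (hα : 0 < α) (hα2 : α ≤ 1 / 2) :
    ∃ n : ℕ, ∀ A : Set X, MeasurableSet A → α ≤ ν.real A → 1 / 2 < ν.real (ballSMul ℓ n A) := by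
  obtain ⟨c, k, hc, H⟩ := h
  set a : Ioc (0 : ℝ) (1 / 2) := ⟨α, hα, hα2⟩
  -- Growth by the factor `1 + c α`, starting from `α`, passes `1 / 2` after `n` steps.
  obtain ⟨n, hn⟩ := pow_unbounded_of_one_lt (1 / 2 / α) (lt_add_of_pos_right 1 (hc a))
  have step : ∀ (A : Set X), MeasurableSet A → α ≤ ν.real A → ∀ m : ℕ,
      (1 + c a) ^ m * α ≤ ν.real (ballSMul ℓ (m * k a) A) ∨
        1 / 2 < ν.real (ballSMul ℓ (m * k a) A) := by
    intro A hA hαA m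
    induction m with
    | zero =>
      left
      rw [pow_zero, one_mul]
      exact hαA.trans (measureReal_mono (subset_ballSMul hℓ _ _))
    | succ m ih =>
      have hsub : ballSMul ℓ (k a) (ballSMul ℓ (m * k a) A) ⊆ ballSMul ℓ ((m + 1) * k a) A := by
        rw [add_mul, one_mul, add_comm]
        exact ballSMul_ballSMul_subset hℓ _ _ _
      have hle := measureReal_mono (μ := ν) (subset_ballSMul hℓ (k a) (ballSMul ℓ (m * k a) A))
      have hle2 := measureReal_mono (μ := ν) hsub
      by_cases hhalf : 1 / 2 < ν.real (ballSMul ℓ (m * k a) A)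
      · right; linarith
      · left
        have h1 := ih.resolve_right hhalf
        have h2 := H a (ballSMul ℓ (m * k a) A) (measurableSet_ballSMul hℓ _ hA)
          (by
            simp only [probReal_univ, mul_one]
            exact hαA.trans (measureReal_mono (subset_ballSMul hℓ _ _)))
          (by simpa using hhalf)
        have h3 : (1 + c a) * ((1 + c a) ^ m * α) ≤
            (1 + c a) * ν.real (ballSMul ℓ (m * k a) A) :=
          mul_le_mul_of_nonneg_left h1 (by linarith [hc a])
        rw [pow_succ]
        linarith
  refine ⟨n * k a, fun A hA hαA => ?_⟩
  rcases step A hA hαA n with h1 | h1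
  · rw [div_lt_iff₀ hα] at hn
    linarith
  · exact h1

/-- Under asymptotic expansion, sets of measure at least `α` have neighbourhoods of measure
larger than `1 - α`, of uniform radius. -/
theorem AsymptoticallyExpanding.exists_compl_lt (h : AsymptoticallyExpanding ℓ ν) {α : ℝ}
    (hα : 0 < α) (hα2 : α ≤ 1 / 2) :
    ∃ n : ℕ, ∀ A : Set X, MeasurableSet A → α ≤ ν.real A → 1 - α < ν.real (ballSMul ℓ n A) := by
  obtain ⟨n, hn⟩ := h.exists_half_lt hℓ hα hα2
  refine ⟨n + n, fun A hA hαA => ?_⟩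
  have h1 := hn A hA hαA
  have hm := measurableSet_ballSMul hℓ n hA
  have hm2 := measurableSet_ballSMul hℓ n hm
  have h2 : 1 - α < ν.real (ballSMul ℓ n (ballSMul ℓ n A)) := by
    by_contra! hle
    -- Otherwise the complement of the double neighbourhood would have an `n`-neighbourhood of
    -- measure above `1 / 2`, disjoint from that of `A`, which is also above `1 / 2`.
    have h3 := hn _ hm2.compl (by rw [probReal_compl_eq_one_sub hm2]; linarith)
    have h4 : Disjoint (ballSMul ℓ n A) (ballSMul ℓ n (ballSMul ℓ n (ballSMul ℓ n A))ᶜ) :=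
      disjoint_ballSMul_comm hℓ disjoint_compl_right
    have h5 := measureReal_union (μ := ν) h4 (measurableSet_ballSMul hℓ n hm2.compl)
    have h6 : ν.real (ballSMul ℓ n A ∪ ballSMul ℓ n (ballSMul ℓ n (ballSMul ℓ n A))ᶜ) ≤ 1 :=
      measureReal_le_one
    linarith
  exact h2.trans_le (measureReal_mono (ballSMul_ballSMul_subset hℓ _ _ _))

/-- Either `ν(A) < α`, or `B_k · A` has measure above `1 - α` and so `ν(C) < α`. In both cases `ν(A)
ν(C) < α < ε²`. -/
theorem AsymptoticallyExpanding.dynQuasiLocal (h : AsymptoticallyExpanding ℓ ν) :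
    DynQuasiLocal ℓ (averagingProjection ν) := by
  intro ε hε
  have hα : 0 < min (ε ^ 2 / 2) (1 / 2) := by positivity
  obtain ⟨k, hk⟩ := h.exists_compl_lt hℓ hα (min_le_right _ _)
  refine ⟨k, fun A C hA hC hAC => ?_⟩
  rw [norm_chi_averagingProjection_chi, ← Real.sqrt_mul measureReal_nonneg,
    Real.sqrt_lt' hε]
  have hA1 : ν.real A ≤ 1 := measureReal_le_one
  have hC1 : ν.real C ≤ 1 := measureReal_le_one
  have hA0 : 0 ≤ ν.real A := measureReal_nonneg
  have hC0 : 0 ≤ ν.real C := measureReal_nonneg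
  have hmin : min (ε ^ 2 / 2) (1 / 2) ≤ ε ^ 2 / 2 := min_le_left _ _
  have hε2 : 0 < ε ^ 2 := by positivity
  by_cases hA' : min (ε ^ 2 / 2) (1 / 2) ≤ ν.real A
  · have h1 := hk A hA hA'
    have hm := measurableSet_ballSMul hℓ k hA
    have h2 : ν.real C ≤ ν.real (ballSMul ℓ k A)ᶜ := by
      have h3 := measureReal_inter_add_sdiff (μ := ν) (s := C) hm
      rw [inter_comm, Measure.real, hAC, ENNReal.toReal_zero, zero_add] at h3
      rw [← h3]
      exact measureReal_mono fun x hx => hx.2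
    rw [probReal_compl_eq_one_sub hm] at h2
    nlinarith
  · nlinarith

end Expansion

/-- A uniformly quasi-local averaging projection comes from an asymptotically expanding action. -/
theorem asymptoticallyExpanding_of_uniformlyQuasiLocal {Γ X : Type*} [Group Γ] [MetricSpace X]
    [MulAction Γ X] {ℓ : Γ → ℕ} [ContinuousConstSMul Γ X] [MeasurableSpace X] [BorelSpace X]
    (hℓ : IsProperLength ℓ) {ν : Measure X} [IsProbabilityMeasure ν]
    (h : UniformlyQuasiLocal ℓ (fun _ => averagingProjection ν)) :
    AsymptoticallyExpanding ℓ ν := by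
  have key : ∀ α : Ioc (0 : ℝ) (1 / 2), ∃ k : ℕ, ∀ A : Set X, MeasurableSet A →
      (α : ℝ) ≤ ν.real A → 3 / 4 < ν.real (ballSMul ℓ k A) := by
    rintro ⟨α, hα, -⟩
    -- If `ν(B_k · A) ≤ 3 / 4`, then `A` and the complement have measures at least `α` and `1 / 4`.
    -- Half of each survives the passage to subsets that are far apart, whose corner has at least
    -- this norm.
    obtain ⟨R, hR, H⟩ := h (√(α / 2) * √(1 / 8)) (by positivity)
    refine ⟨⌈R⌉₊, fun A hA hαA => ?_⟩
    by_contra! hle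
    have hm := measurableSet_ballSMul hℓ ⌈R⌉₊ hA
    obtain ⟨T, hT, A', C', hA', hC', h1, h2, h3⟩ := exists_setDist_warpedDist_gt hℓ ν hA hm.compl
      disjoint_compl_right (a := α / 2) (c := 1 / 8) (by dsimp only at hαA; linarith)
      (by positivity) (by rw [probReal_compl_eq_one_sub hm]; linarith) (by norm_num)
    have h4 := H ⟨T, hT⟩ A' C' hA' hC' (lt_of_lt_of_le
      ((ENNReal.ofReal_lt_ofReal_iff (by positivity)).2 (by linarith [Nat.le_ceil R])) h3)
    rw [norm_chi_averagingProjection_chi] at h4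
    exact absurd h4 (not_lt.2 (by gcongr))
  choose k hk using key
  -- A neighbourhood above `3 / 4 = (1 + 1 / 2) · 1 / 2` gives the expansion constant `1 / 2` for
  -- all `α`.
  refine ⟨fun _ => 1 / 2, k, fun _ => by norm_num, fun α A hA h1 h2 => ?_⟩
  rw [probReal_univ] at h1 h2
  linarith [hk α A hA (by linarith)]

/-! ### The Druţu--Nowak projection as a fibrewise average -/

section L2Lemmas

variable {Y : Type*} [MeasurableSpace Y] {μ : Measure Y}

theorem enorm_sq_eq_lintegral (f : L2 μ) : ‖f‖ₑ ^ 2 = ∫⁻ x, ‖f x‖ₑ ^ 2 ∂μ := by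
  rw [Lp.enorm_def, eLpNorm_eq_lintegral_rpow_enorm_toReal (by norm_num) (by norm_num)]
  simp only [ENNReal.toReal_ofNat, ENNReal.rpow_ofNat, one_div]
  rw [← ENNReal.rpow_natCast, ← ENNReal.rpow_mul]
  norm_num

theorem lintegral_enorm_sq_lt_top (f : L2 μ) : ∫⁻ x, ‖f x‖ₑ ^ 2 ∂μ < ∞ := by
  rw [← enorm_sq_eq_lintegral]
  exact ENNReal.pow_lt_top enorm_lt_top

theorem lintegral_sq_le_mul {f : Y → ℝ≥0∞} (hf : AEMeasurable f μ) :
    (∫⁻ x, f x ∂μ) ^ 2 ≤ μ univ * ∫⁻ x, f x ^ 2 ∂μ := by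
  have h := ENNReal.lintegral_mul_le_Lp_mul_Lq μ (p := 2) (q := 2) (by constructor <;> norm_num)
    (aemeasurable_const (b := (1 : ℝ≥0∞))) hf
  simp only [Pi.mul_apply, one_mul, one_pow, lintegral_const, ENNReal.rpow_ofNat,
    one_div] at h
  calc _ ≤ _ := pow_le_pow_left' h 2
    _ = _ := by
      have h2 : ∀ a : ℝ≥0∞, (a ^ (2⁻¹ : ℝ)) ^ 2 = a := fun a => by
        rw [← ENNReal.rpow_natCast, ← ENNReal.rpow_mul]
        norm_num
      rw [mul_pow, h2, h2]

theorem memLp_two_of_lintegral_lt_top {f : Y → ℂ} (hf : AEStronglyMeasurable f μ)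
    (h : ∫⁻ x, ‖f x‖ₑ ^ 2 ∂μ < ∞) : MemLp f 2 μ := by
  refine ⟨hf, ?_⟩
  rw [eLpNorm_eq_lintegral_rpow_enorm_toReal (by norm_num) (by norm_num)]
  simp only [ENNReal.toReal_ofNat, ENNReal.rpow_ofNat, one_div]
  exact ENNReal.rpow_lt_top_of_nonneg (by norm_num) h.ne

theorem enorm_integral_sq_le {X : Type*} [MeasurableSpace X] {ν : Measure X} {f : X → ℂ}
    (hf : AEStronglyMeasurable f ν) (C : Set X) :
    ‖∫ x in C, f x ∂ν‖ₑ ^ 2 ≤ ν C * ∫⁻ x, ‖f x‖ₑ ^ 2 ∂ν := by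
  calc _ ≤ (∫⁻ x in C, ‖f x‖ₑ ∂ν) ^ 2 := pow_le_pow_left' (enorm_integral_le_lintegral_enorm _) 2
    _ ≤ ν.restrict C univ * ∫⁻ x in C, ‖f x‖ₑ ^ 2 ∂ν := lintegral_sq_le_mul hf.restrict.enorm
    _ ≤ _ := by
      rw [Measure.restrict_apply_univ]
      gcongr
      exact Measure.restrict_le_self

end L2Lemmas

section DrutuNowak

variable {X : Type*} [MeasurableSpace X] (ν : Measure X) [IsProbabilityMeasure ν]

theorem ae_fiber {p : Cone X → Prop} (h : ∀ᵐ z ∂coneMeasure ν, p z) :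
    ∀ᵐ t ∂lebesgueRay, ∀ᵐ x ∂ν, p (x, t) :=
  Measure.ae_ae_of_ae_prod
    ((Measure.measurePreserving_swap (μ := lebesgueRay) (ν := ν)).quasiMeasurePreserving.ae h)

theorem lintegral_coneMeasure {f : Cone X → ℝ≥0∞} (hf : AEMeasurable f (coneMeasure ν)) :
    ∫⁻ z, f z ∂coneMeasure ν = ∫⁻ t, ∫⁻ x, f (x, t) ∂ν ∂lebesgueRay :=
  lintegral_prod_symm _ hf

theorem ae_fiber_memLp (F : L2 (coneMeasure ν)) :
    ∀ᵐ t ∂lebesgueRay, MemLp (fun x => F (x, t)) 2 ν := by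
  have hF := Lp.stronglyMeasurable F
  have h := lintegral_enorm_sq_lt_top F
  rw [lintegral_coneMeasure ν (hF.enorm.pow_const 2).aemeasurable] at h
  filter_upwards [ae_lt_top (Measurable.lintegral_prod_left' (hF.enorm.pow_const 2)) h.ne]
    with t ht
  exact memLp_two_of_lintegral_lt_top
    (hF.comp_measurable measurable_prodMk_right).aestronglyMeasurable ht

theorem memLp_fiberIntegral (F : L2 (coneMeasure ν)) :
    MemLp (fun t => ∫ x, F (x, t) ∂ν) 2 lebesgueRay := by
  have hF := Lp.stronglyMeasurable F
  refine memLp_two_of_lintegral_lt_top hF.integral_prod_left'.aestronglyMeasurable ?_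
  have h := lintegral_enorm_sq_lt_top F
  rw [lintegral_coneMeasure ν (hF.enorm.pow_const 2).aemeasurable] at h
  refine lt_of_le_of_lt (lintegral_mono fun t => ?_) h
  have := enorm_integral_sq_le (ν := ν) (f := fun x => F (x, t))
      (hF.comp_measurable measurable_prodMk_right).aestronglyMeasurable univ
  simpa using this

/-- The fibre integrals of `F` form an `L²` function `g` by Cauchy–Schwarz, and `F - 1 ⊗ g` has mean
zero on almost every fibre, hence is orthogonal to every `1 ⊗ h`. -/
theorem drutuNowak_ae (F : L2 (coneMeasure ν)) :
    drutuNowak ν F =ᵐ[coneMeasure ν] fun p => ∫ x, F (x, p.2) ∂ν := by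
  have hg := memLp_fiberIntegral ν F
  set g : L2 lebesgueRay := hg.toLp with hgdef
  have key : drutuNowak ν F = oneTensor ν g := by
    refine Submodule.eq_starProjection_of_mem_of_inner_eq_zero ⟨g, rfl⟩ ?_
    rintro _ ⟨h, rfl⟩
    change inner ℂ (F - oneTensor ν g) (oneTensor ν h) = 0
    rw [L2.inner_def]
    have hint := L2.integrable_inner (𝕜 := ℂ) (F - oneTensor ν g) (oneTensor ν h)
    refine (integral_prod_symm _ hint).trans ?_
    refine integral_eq_zero_of_ae ?_
    filter_upwards [ae_fiber ν (Lp.coeFn_sub F (oneTensor ν g)), ae_fiber ν (oneTensor_ae ν g),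
      ae_fiber ν (oneTensor_ae ν h), ae_fiber_memLp ν F, hg.coeFn_toLp] with t h1 h2 h3 h4 h5
    have e : ∀ᵐ x ∂ν, inner ℂ ((F - oneTensor ν g : L2 (coneMeasure ν)) (x, t))
        (oneTensor ν h (x, t)) = (starRingEnd ℂ) (F (x, t) - ∫ x, F (x, t) ∂ν) * h t := by
      filter_upwards [h1, h2, h3] with x h1 h2 h3
      rw [h1, Pi.sub_apply, h2, h3, h5]
      simp [mul_comm]
    rw [integral_congr_ae e, integral_mul_const, integral_conj,
      integral_sub (h4.integrable (by norm_num)) (integrable_const _)]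
    simp
  rw [key]
  filter_upwards [oneTensor_ae ν g, (Measure.quasiMeasurePreserving_snd (μ := ν)
    (ν := lebesgueRay)).ae hg.coeFn_toLp] with p h1 h2
  rw [h1, h2]

theorem drutuNowak_ae_of_ae_eq (F : L2 (coneMeasure ν)) {Φ : Cone X → ℂ}
    (h : F =ᵐ[coneMeasure ν] Φ) :
    drutuNowak ν F =ᵐ[coneMeasure ν] fun p => ∫ x, Φ (x, p.2) ∂ν := by
  filter_upwards [drutuNowak_ae ν F, (Measure.quasiMeasurePreserving_snd (μ := ν)
    (ν := lebesgueRay)).ae (ae_fiber ν h)] with p h1 h2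
  rw [h1]
  exact integral_congr_ae h2

/-- On the fibre over `t` the corner is of rank one, with squared norm `ν(A_t) ν(C_t)`; integrating
the fibrewise Cauchy–Schwarz inequality over `t` gives the bound. -/
theorem norm_chi_drutuNowak_chi_le {A C : Set (Cone X)} (hA : MeasurableSet A)
    (hC : MeasurableSet C) {b : ℝ} (hb : 0 ≤ b)
    (h : ∀ t, ν.real ((fun x => (x, t)) ⁻¹' A) * ν.real ((fun x => (x, t)) ⁻¹' C) ≤ b ^ 2) :
    ‖chi _ hA ∘L drutuNowak ν ∘L chi _ hC‖ ≤ b := by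
  refine ContinuousLinearMap.opNorm_le_bound _ hb fun f => ?_
  simp only [ContinuousLinearMap.comp_apply]
  have hf := Lp.stronglyMeasurable f
  have hCt : ∀ t : Ici (1 : ℝ), MeasurableSet ((fun x : X => (x, t)) ⁻¹' C) := fun t =>
    measurable_prodMk_right hC
  have hAt : ∀ t : Ici (1 : ℝ), MeasurableSet ((fun x : X => (x, t)) ⁻¹' A) := fun t =>
    measurable_prodMk_right hA
  have e : ∀ᵐ p ∂coneMeasure ν, chi _ hA (drutuNowak ν (chi _ hC f)) p =
      A.indicator (fun p : Cone X => ∫ x in (fun x => (x, p.2)) ⁻¹' C, f (x, p.2) ∂ν) p := by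
    filter_upwards [chi_apply_ae _ hA (drutuNowak ν (chi _ hC f)),
      drutuNowak_ae_of_ae_eq ν _ (chi_apply_ae _ hC f)] with p h1 h2
    rw [h1]
    by_cases hp : p ∈ A
    · rw [indicator_of_mem hp, indicator_of_mem hp, h2, ← integral_indicator (hCt p.2)]
      rfl
    · rw [indicator_of_notMem hp, indicator_of_notMem hp]
  have hmeas : AEMeasurable (fun p => ‖chi (coneMeasure ν) hA (drutuNowak ν (chi _ hC f)) p‖ₑ ^ 2)
      (coneMeasure ν) := ((Lp.stronglyMeasurable _).enorm.pow_const 2).aemeasurable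
  have key : ‖chi _ hA (drutuNowak ν (chi _ hC f))‖ₑ ^ 2 ≤ ENNReal.ofReal (b ^ 2) * ‖f‖ₑ ^ 2 := by
    rw [enorm_sq_eq_lintegral, enorm_sq_eq_lintegral, lintegral_coneMeasure ν hmeas,
      lintegral_coneMeasure ν (hf.enorm.pow_const 2).aemeasurable,
      ← lintegral_const_mul _ (Measurable.lintegral_prod_left' (hf.enorm.pow_const 2))]
    refine lintegral_mono_ae ?_
    filter_upwards [ae_fiber ν e] with t ht
    have hst : AEStronglyMeasurable (fun x => f (x, t)) ν :=
      (hf.comp_measurable measurable_prodMk_right).aestronglyMeasurable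
    calc ∫⁻ x, ‖chi _ hA (drutuNowak ν (chi _ hC f)) (x, t)‖ₑ ^ 2 ∂ν
        = ∫⁻ x, ((fun x => (x, t)) ⁻¹' A).indicator
            (fun _ => ‖∫ x in (fun x => (x, t)) ⁻¹' C, f (x, t) ∂ν‖ₑ ^ 2) x ∂ν := by
          refine lintegral_congr_ae ?_
          filter_upwards [ht] with x hx
          rw [hx]
          by_cases hp : (x, t) ∈ A
          · rw [indicator_of_mem hp, indicator_of_mem (by exact hp)]
          · rw [indicator_of_notMem hp, indicator_of_notMem (by exact hp)]
            simp
      _ = ‖∫ x in (fun x => (x, t)) ⁻¹' C, f (x, t) ∂ν‖ₑ ^ 2 * ν ((fun x => (x, t)) ⁻¹' A) := by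
          rw [lintegral_indicator_const (hAt t)]
      _ ≤ (ν ((fun x => (x, t)) ⁻¹' C) * ∫⁻ x, ‖f (x, t)‖ₑ ^ 2 ∂ν) *
            ν ((fun x => (x, t)) ⁻¹' A) := by
          gcongr
          exact enorm_integral_sq_le hst _
      _ = (ν ((fun x => (x, t)) ⁻¹' A) * ν ((fun x => (x, t)) ⁻¹' C)) *
            ∫⁻ x, ‖f (x, t)‖ₑ ^ 2 ∂ν := by ring
      _ ≤ _ := by
          gcongr
          rw [← ofReal_measureReal, ← ofReal_measureReal,
            ← ENNReal.ofReal_mul measureReal_nonneg]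
          exact ENNReal.ofReal_le_ofReal (h t)
  have h2 : ‖chi _ hA (drutuNowak ν (chi _ hC f))‖ ^ 2 ≤ (b * ‖f‖) ^ 2 := by
    rw [← ofReal_norm, ← ofReal_norm, ← ENNReal.ofReal_pow (norm_nonneg _),
      ← ENNReal.ofReal_pow (norm_nonneg _), ← ENNReal.ofReal_mul (by positivity),
      ENNReal.ofReal_le_ofReal_iff (by positivity), ← mul_pow] at key
    exact key
  exact (sq_le_sq₀ (norm_nonneg _) (by positivity)).1 h2

theorem lebesgueRay_apply {I : Set (Ici (1 : ℝ))} :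
    lebesgueRay I = volume (Subtype.val '' I) := by
  rw [lebesgueRay, (MeasurableEmbedding.subtype_coe measurableSet_Ici).comap_apply]

/-- The test function `1_{C × I}` is sent to `ν(C) 1_{A × I}`. As `I` has unit length, the norms are
those of the sets in `X`. -/
theorem le_norm_chi_drutuNowak_chi {A C : Set X} (hA : MeasurableSet A) (hC : MeasurableSet C)
    {I : Set (Ici (1 : ℝ))} (hI : MeasurableSet I) (hI1 : lebesgueRay I = 1) :
    √(ν.real A) * √(ν.real C) ≤
      ‖chi (coneMeasure ν) (hA.prod hI) ∘L drutuNowak ν ∘L chi _ (hC.prod hI)‖ := by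
  have hprod : ∀ B : Set X, coneMeasure ν (B ×ˢ I) = ν B := fun B => by
    rw [coneMeasure, Measure.prod_prod, hI1, mul_one]
  have hreal : ∀ B : Set X, (coneMeasure ν).real (B ×ˢ I) = ν.real B := fun B => by
    rw [Measure.real, hprod, Measure.real]
  have hfin : ∀ B : Set X, coneMeasure ν (B ×ˢ I) ≠ ∞ := fun B => by
    rw [hprod]; exact measure_ne_top _ _
  rcases eq_or_ne (ν.real C) 0 with h0 | h0
  · simp [h0]
  have hpos : 0 < √(ν.real C) := Real.sqrt_pos.2 (lt_of_le_of_ne measureReal_nonneg h0.symm)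
  set f : L2 (coneMeasure ν) := indicatorConstLp 2 (hC.prod hI) (hfin C) (1 : ℂ) with hf
  have hfae : f =ᵐ[coneMeasure ν] (C ×ˢ I).indicator fun _ => 1 := indicatorConstLp_coeFn
  have e : (chi (coneMeasure ν) (hA.prod hI) ∘L drutuNowak ν ∘L chi _ (hC.prod hI)) f =
      indicatorConstLp 2 (hA.prod hI) (hfin A) (ν.real C : ℂ) := by
    have h1 : chi (coneMeasure ν) (hC.prod hI) f =ᵐ[coneMeasure ν]
        (C ×ˢ I).indicator fun _ => 1 := by
      filter_upwards [chi_apply_ae _ (hC.prod hI) f, hfae] with p h1 h2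
      rw [h1]
      by_cases hp : p ∈ C ×ˢ I
      · rw [indicator_of_mem hp, h2]
      · rw [indicator_of_notMem hp, indicator_of_notMem hp]
    refine Lp.ext ?_
    simp only [ContinuousLinearMap.comp_apply]
    filter_upwards [chi_apply_ae _ (hA.prod hI) (drutuNowak ν (chi _ (hC.prod hI) f)),
      drutuNowak_ae_of_ae_eq ν _ h1, indicatorConstLp_coeFn (p := 2) (hs := hA.prod hI)
        (hμs := hfin A) (c := (ν.real C : ℂ))] with p h2 h3 h4
    rw [h2, h4]
    by_cases hp : p ∈ A ×ˢ I
    · rw [indicator_of_mem hp, indicator_of_mem hp, h3]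
      have h5 : (fun x => (C ×ˢ I).indicator (fun _ => (1 : ℂ)) (x, p.2)) =
          C.indicator fun _ => 1 := by
        ext x
        by_cases hx : x ∈ C <;> simp [hx, hp.2]
      rw [h5, integral_indicator_const _ hC]
      simp
    · rw [indicator_of_notMem hp, indicator_of_notMem hp]
  have h := (chi (coneMeasure ν) (hA.prod hI) ∘L drutuNowak ν ∘L chi _ (hC.prod hI)).le_opNorm f
  rw [e, hf, norm_indicatorConstLp_two, norm_indicatorConstLp_two, hreal, hreal, norm_one,
    one_mul] at h
  have h2 : ‖(ν.real C : ℂ)‖ = √(ν.real C) * √(ν.real C) := by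
    rw [Real.mul_self_sqrt measureReal_nonneg]; simp
  rw [h2] at h
  refine le_of_mul_le_mul_right ?_ hpos
  linarith

end DrutuNowak

/-! ### Quasi-locality passes from the space to the cone and back to its levels -/

section QuasiLocality

theorem coneDist_smul_le {Γ X : Type*} [Group Γ] [MetricSpace X] [MulAction Γ X]
    {ℓ : Γ → ℕ} (hℓ : IsProperLength ℓ) (γ : Γ) (x : X) (t : Ici (1 : ℝ)) :
    coneDist ℓ (x, t) (γ • x, t) ≤ ℓ γ := by
  have ht : (0 : ℝ) < t := lt_of_lt_of_le one_pos t.2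
  simpa [coneDist] using (isGreatest_warpedDist (X := X) hℓ ht).1.2.2 γ x

variable {Γ X : Type*} [Group Γ] [MetricSpace X] [MulAction Γ X] {ℓ : Γ → ℕ}
  [MeasurableSpace X] {ν : Measure X} [IsProbabilityMeasure ν]

/-- A group element of length at most `k` moves points of the cone by at most `k` within a fibre, so
fibres of sets further apart than `k + 1` are separated by `B_k`. -/
theorem quasiLocal_drutuNowak_of_dynQuasiLocal (hℓ : IsProperLength ℓ)
    (h : DynQuasiLocal ℓ (averagingProjection ν)) : QuasiLocal (coneDist ℓ) (drutuNowak ν) := by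
  intro ε hε
  obtain ⟨k, hk⟩ := h (ε / 2) (half_pos hε)
  refine ⟨k + 1, by positivity, fun A C hA hC hAC => ?_⟩
  refine (norm_chi_drutuNowak_chi_le ν hA hC (half_pos hε).le fun t => ?_).trans_lt
    (half_lt_self hε)
  have hdisj : ballSMul ℓ k ((fun x => (x, t)) ⁻¹' A) ∩ (fun x => (x, t)) ⁻¹' C = ∅ := by
    rw [eq_empty_iff_forall_notMem]
    rintro x ⟨hx, hxC⟩
    obtain ⟨γ, hγ, a, ha, rfl⟩ := mem_ballSMul.1 hx
    have h1 := lt_of_lt_setDist hAC ha hxC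
    have h2 := coneDist_smul_le hℓ γ a t
    have h3 : (ℓ γ : ℝ) ≤ k := by exact_mod_cast hγ
    linarith
  have h1 := hk _ _ (measurable_prodMk_right hA) (measurable_prodMk_right hC)
    (by rw [hdisj]; exact measure_empty)
  rw [norm_chi_averagingProjection_chi, ← Real.sqrt_mul measureReal_nonneg,
    Real.sqrt_lt' (half_pos hε)] at h1
  exact h1.le

theorem uniformlyQuasiLocal_of_quasiLocal_drutuNowak (hℓ : IsProperLength ℓ)
    (h : QuasiLocal (coneDist ℓ) (drutuNowak ν)) :
    UniformlyQuasiLocal ℓ (fun _ => averagingProjection ν) := by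
  intro ε hε
  obtain ⟨R, hR, H⟩ := h ε hε
  -- The infimum of distances above `R + 1` is only known to be at least `R + 1`; the extra unit
  -- restores strictness. Distances between points of the slab over `[t, t + 1]` are at least
  -- `d_Γ^t`, since warped metrics increase with `t`.
  refine ⟨R + 1, by positivity, fun t A C hA hC hAC => ?_⟩
  have ht : (0 : ℝ) < t := lt_of_lt_of_le one_pos t.2
  have hI : MeasurableSet (Subtype.val ⁻¹' Icc (t : ℝ) (t + 1) : Set (Ici (1 : ℝ))) :=
    measurable_subtype_coe measurableSet_Icc
  have hI1 : lebesgueRay (Subtype.val ⁻¹' Icc (t : ℝ) (t + 1) : Set (Ici (1 : ℝ))) = 1 := by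
    rw [lebesgueRay_apply, Subtype.image_preimage_coe, inter_eq_right.2, Real.volume_Icc]
    · simp
    · exact fun s hs => le_trans t.2 hs.1
  rw [norm_chi_averagingProjection_chi]
  refine (le_norm_chi_drutuNowak_chi ν hA hC hI hI1).trans_lt (H _ _ _ _ ?_)
  refine lt_of_lt_of_le ((ENNReal.ofReal_lt_ofReal_iff (by positivity)).2 (lt_add_one R))
    (le_setDist ?_)
  rintro ⟨a, s⟩ ⟨ha, hs⟩ ⟨c, s'⟩ ⟨hc, hs'⟩
  have h1 := lt_of_lt_setDist hAC ha hc
  have h2 := warpedDist_mono (X := X) hℓ ht (le_min hs.1 hs'.1) a c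
  change R + 1 ≤ warpedDist ℓ (min (s : ℝ) s') a c + |(s : ℝ) - s'|
  dsimp only at h2
  linarith [abs_nonneg ((s : ℝ) - s')]

end QuasiLocality

/-! ### Algebra of operators of finite propagation -/

section Chi

variable {Y : Type*} [MeasurableSpace Y] {μ : Measure Y}

theorem chi_comp_chi {A C : Set Y} (hA : MeasurableSet A) (hC : MeasurableSet C) :
    chi μ hA ∘L chi μ hC = chi μ (hA.inter hC) := by
  refine ContinuousLinearMap.ext fun f => Lp.ext ?_
  rw [ContinuousLinearMap.comp_apply]
  filter_upwards [chi_apply_ae μ hA (chi μ hC f), chi_apply_ae μ hC f,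
    chi_apply_ae μ (hA.inter hC) f] with x h1 h2 h3
  rw [h1, h3]
  by_cases hx : x ∈ A <;> by_cases hx' : x ∈ C <;> simp [hx, hx', h2]

theorem chi_eq_zero {A : Set Y} (hA : MeasurableSet A) (h : μ A = 0) : chi μ hA = 0 := by
  refine ContinuousLinearMap.ext fun f => Lp.ext ?_
  filter_upwards [chi_apply_ae μ hA f, Lp.coeFn_zero ℂ 2 μ,
    measure_eq_zero_iff_ae_notMem.1 h] with x h1 h2 h3
  rw [h1, indicator_of_notMem h3]
  exact h2.symm

theorem chi_univ : chi μ (MeasurableSet.univ : MeasurableSet (univ : Set Y)) = 1 := by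
  refine ContinuousLinearMap.ext fun f => Lp.ext ?_
  filter_upwards [chi_apply_ae μ MeasurableSet.univ f] with x h1
  rw [h1, indicator_univ]
  rfl

theorem chi_add_chi_compl {A : Set Y} (hA : MeasurableSet A) :
    chi μ hA + chi μ hA.compl = 1 := by
  refine ContinuousLinearMap.ext fun f => Lp.ext ?_
  rw [_root_.add_apply]
  filter_upwards [chi_apply_ae μ hA f, chi_apply_ae μ hA.compl f,
    Lp.coeFn_add (chi μ hA f) (chi μ hA.compl f)] with x h1 h2 h3
  rw [h3, Pi.add_apply, h1, h2]
  by_cases hx : x ∈ A <;> simp [hx]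

theorem inner_chi_left {A : Set Y} (hA : MeasurableSet A) (f g : L2 μ) :
    inner ℂ (chi μ hA f) g = inner ℂ f (chi μ hA g) := by
  rw [L2.inner_def, L2.inner_def]
  refine integral_congr_ae ?_
  filter_upwards [chi_apply_ae μ hA f, chi_apply_ae μ hA g] with x h1 h2
  rw [h1, h2]
  by_cases hx : x ∈ A <;> simp [hx]

theorem isSelfAdjoint_chi {A : Set Y} (hA : MeasurableSet A) : IsSelfAdjoint (chi μ hA) :=
  ContinuousLinearMap.isSelfAdjoint_iff_isSymmetric.2 fun f g => inner_chi_left hA f g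

theorem norm_chi_le {A : Set Y} (hA : MeasurableSet A) : ‖chi μ hA‖ ≤ 1 :=
  LinearMap.mkContinuous_norm_le _ zero_le_one _

end Chi

/-! ### Operators of finite propagation, and powers of an operator with a spectral gap -/

section Propagation

variable {Γ Z : Type*} [Group Γ] [MulAction Γ Z] [MeasurableSpace Z] {ℓ : Γ → ℕ}
  {μ : Measure Z}

theorem dynFinitePropagation_chi (hℓ : IsProperLength ℓ) {Y : Set Z} (hY : MeasurableSet Y) :
    DynFinitePropagation ℓ (chi μ hY) := by
  refine ⟨0, fun A C hA hC h => ?_⟩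
  rw [chi_comp_chi, chi_comp_chi]
  refine chi_eq_zero _ (measure_mono_null ?_ h)
  exact fun x hx => ⟨subset_ballSMul hℓ 0 A hx.1, hx.2.2⟩

theorem DynFinitePropagation.smul {T : Op μ} (hT : DynFinitePropagation ℓ T) (c : ℂ) :
    DynFinitePropagation ℓ (c • T) := by
  obtain ⟨k, hk⟩ := hT
  refine ⟨k, fun A C hA hC h => ?_⟩
  rw [ContinuousLinearMap.smul_comp, ContinuousLinearMap.comp_smul, hk A C hA hC h, smul_zero]

theorem DynFinitePropagation.sub {S T : Op μ} (hS : DynFinitePropagation ℓ S)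
    (hT : DynFinitePropagation ℓ T) : DynFinitePropagation ℓ (S - T) := by
  obtain ⟨j, hj⟩ := hS
  obtain ⟨k, hk⟩ := hT
  refine ⟨max j k, fun A C hA hC h => ?_⟩
  rw [ContinuousLinearMap.sub_comp, ContinuousLinearMap.comp_sub,
    hj A C hA hC (measure_mono_null (inter_subset_inter_left _
      (ballSMul_mono_radius (le_max_left j k) A)) h),
    hk A C hA hC (measure_mono_null (inter_subset_inter_left _
      (ballSMul_mono_radius (le_max_right j k) A)) h), sub_zero]

/-- Insert `χ_D + χ_{Dᶜ} = 1` between the factors, with `D = B_j · A`: `S` kills the part outside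
`D`, and `T` the part inside, because `B_k · D ⊆ B_{k+j} · A`. -/
theorem DynFinitePropagation.mul [MeasurableConstSMul Γ Z] (hℓ : IsProperLength ℓ) {S T : Op μ}
    (hS : DynFinitePropagation ℓ S) (hT : DynFinitePropagation ℓ T) :
    DynFinitePropagation ℓ (S * T) := by
  obtain ⟨j, hj⟩ := hS
  obtain ⟨k, hk⟩ := hT
  refine ⟨k + j, fun A C hA hC h => ?_⟩
  have hD := measurableSet_ballSMul hℓ j hA
  have h1 : chi μ hA * S * chi μ hD.compl = 0 :=
    hj A _ hA hD.compl (by rw [inter_compl_self]; exact measure_empty)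
  have h2 : chi μ hD * (T * chi μ hC) = 0 :=
    hk _ C hD hC (measure_mono_null (inter_subset_inter_left _
      (ballSMul_ballSMul_subset hℓ k j A)) h)
  calc chi μ hA * ((S * T) * chi μ hC)
      = chi μ hA * S * (chi μ hD + chi μ hD.compl) * T * chi μ hC := by
        rw [chi_add_chi_compl, mul_one]; simp only [mul_assoc]
    _ = chi μ hA * S * (chi μ hD * (T * chi μ hC)) +
        chi μ hA * S * chi μ hD.compl * T * chi μ hC := by noncomm_ring
    _ = 0 := by rw [h1, h2]; simp

theorem DynFinitePropagation.pow [MeasurableConstSMul Γ Z] (hℓ : IsProperLength ℓ) {S : Op μ}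
    (hS : DynFinitePropagation ℓ S) (n : ℕ) : DynFinitePropagation ℓ (S ^ n) := by
  induction n with
  | zero =>
    rw [pow_zero, ← chi_univ]
    exact dynFinitePropagation_chi hℓ _
  | succ n ih => rw [pow_succ]; exact ih.mul hℓ hS

/-- A Poincaré inequality for a form of finite propagation makes the projection onto its kernel
a norm limit of operators of finite propagation. -/
theorem exists_dynFinitePropagation_norm_sub_lt [MeasurableConstSMul Γ Z]
    (hℓ : IsProperLength ℓ) {P : Op μ} (hP : IsSelfAdjoint P) {Y : Set Z} (hY : MeasurableSet Y)
    {s : ℝ} (hs : s ≠ 0) (hPYP : P * chi μ hY * P = (s : ℂ) • P)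
    {H : Type*} [NormedAddCommGroup H] [InnerProductSpace ℂ H] [CompleteSpace H]
    (D : L2 μ →L[ℂ] H) (hDY : D ∘L chi μ hY = D) (hDP : D ∘L chi μ hY ∘L P = 0) (C : ℝ)
    (hC : ∀ g : L2 μ, chi μ hY g = g → P g = 0 → ‖g‖ ^ 2 ≤ C * ‖D g‖ ^ 2)
    (hD : DynFinitePropagation ℓ (ContinuousLinearMap.adjoint D ∘L D)) {ε : ℝ} (hε : 0 < ε) :
    ∃ S : Op μ, DynFinitePropagation ℓ S ∧ ‖S - chi μ hY * P * chi μ hY‖ < ε := by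
  set χ : Op μ := chi μ hY with hχ
  set L : Op μ := ContinuousLinearMap.adjoint D ∘L D with hL
  -- Small enough that `κ ‖D‖² ≤ 1`, which keeps `χ - κ L` between `0` and `χ`.
  set κ : ℝ := 1 / (‖D‖ ^ 2 + 1) with hκ
  have hκ0 : 0 < κ := by positivity
  have hκ1 : κ ≤ 1 := by
    rw [hκ, div_le_one (by positivity)]; nlinarith [sq_nonneg ‖D‖]
  -- Enlarging the Poincaré constant to at least `1` makes `κ / C' ≤ 1`, so the contraction factor
  -- below is a genuine square root.
  set C' : ℝ := max C 1
  have hC'1 : 1 ≤ C' := le_max_right _ _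
  set S : Op μ := χ - (κ : ℂ) • L with hS
  have hχsa : star χ = χ := isSelfAdjoint_chi hY
  have hPsa : star P = P := hP
  have hχχ : χ * χ = χ := by
    have := chi_comp_chi (μ := μ) hY hY
    simp only [inter_self] at this
    exact this
  have hLsa : star L = L := by
    rw [hL, ContinuousLinearMap.star_eq_adjoint, ContinuousLinearMap.adjoint_comp,
      ContinuousLinearMap.adjoint_adjoint]
  have hLχ : L * χ = L := by
    change ContinuousLinearMap.adjoint D ∘L (D ∘L χ) = L
    rw [hDY]
  have hχL : χ * L = L := by simpa [hLsa, hχsa] using congrArg star hLχ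
  have hLχP : L * χ * P = 0 := by
    change ContinuousLinearMap.adjoint D ∘L (D ∘L χ ∘L P) = 0
    rw [hDP, ContinuousLinearMap.comp_zero]
  have hPχL : P * (χ * L) = 0 := by simpa [hLsa, hχsa, hPsa] using congrArg star hLχP
  have hSχP : S * (χ * P) = χ * P := by
    rw [hS, sub_mul, smul_mul_assoc, ← mul_assoc L, hLχP, smul_zero, sub_zero, ← mul_assoc, hχχ]
  have hχS : χ * S = S := by rw [hS, mul_sub, mul_smul_comm, hχL, hχχ]
  have hPS : P * S = P * χ := by
    rw [← hχS, hS, mul_sub, mul_smul_comm, mul_sub, mul_smul_comm, hPχL, hχχ, smul_zero, sub_zero]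
  -- Expanding the square gives `‖v‖² - 2κ‖Dv‖² + κ²‖Lv‖² ≤ ‖v‖² - κ‖Dv‖²`, and the Poincaré
  -- inequality bounds `‖Dv‖²` below. The space of such `v` is invariant under `S` by `hχS` and
  -- `hPS`, so the estimate iterates.
  have hcontr : ∀ v : L2 μ, χ v = v → P v = 0 → ‖S v‖ ^ 2 ≤ (1 - κ / C') * ‖v‖ ^ 2 := by
    intro v hv hPv
    have h1 : S v = v - (κ : ℂ) • L v := by
      rw [hS, _root_.sub_apply, hv, _root_.smul_apply]
    have h2 : RCLike.re (inner ℂ v (L v)) = ‖D v‖ ^ 2 := by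
      rw [hL, ContinuousLinearMap.comp_apply, ContinuousLinearMap.adjoint_inner_right]
      exact inner_self_eq_norm_sq (𝕜 := ℂ) (D v)
    have h3 : ‖L v‖ ≤ ‖D‖ * ‖D v‖ := by
      rw [hL, ContinuousLinearMap.comp_apply]
      exact (ContinuousLinearMap.le_opNorm _ _).trans_eq (by
        rw [LinearIsometryEquiv.norm_map])
    have h4 : ‖L v‖ ^ 2 ≤ ‖D‖ ^ 2 * ‖D v‖ ^ 2 := by
      rw [← mul_pow]; exact pow_le_pow_left₀ (norm_nonneg _) h3 2
    have h5 : κ * ‖D‖ ^ 2 ≤ 1 := by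
      rw [hκ, one_div, inv_mul_le_one₀ (by positivity)]; linarith
    have h6 : ‖v‖ ^ 2 ≤ C' * ‖D v‖ ^ 2 :=
      (hC v hv hPv).trans (mul_le_mul_of_nonneg_right (le_max_left _ _) (by positivity))
    have h7 : ‖S v‖ ^ 2 = ‖v‖ ^ 2 - 2 * κ * ‖D v‖ ^ 2 + κ ^ 2 * ‖L v‖ ^ 2 := by
      rw [h1, norm_sub_sq (𝕜 := ℂ), inner_smul_right, norm_smul]
      have : RCLike.re ((κ : ℂ) * inner ℂ v (L v)) = κ * ‖D v‖ ^ 2 := by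
        rw [← h2]; simp
      rw [this]
      simp [mul_pow]
      ring
    have h8 : κ ^ 2 * ‖L v‖ ^ 2 ≤ κ * ‖D v‖ ^ 2 := by
      calc κ ^ 2 * ‖L v‖ ^ 2 ≤ κ ^ 2 * (‖D‖ ^ 2 * ‖D v‖ ^ 2) := by gcongr
        _ = (κ * ‖D‖ ^ 2) * (κ * ‖D v‖ ^ 2) := by ring
        _ ≤ 1 * (κ * ‖D v‖ ^ 2) := by gcongr
        _ = _ := one_mul _
    have h9 : κ / C' * ‖v‖ ^ 2 ≤ κ * ‖D v‖ ^ 2 := by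
      rw [div_mul_eq_mul_div, div_le_iff₀ (by linarith)]
      nlinarith
    linarith
  set q : ℝ := √(1 - κ / C')
  have hq1 : q < 1 := by
    rw [Real.sqrt_lt' one_pos]
    have : 0 < κ / C' := by positivity
    linarith
  have hiter : ∀ (n : ℕ) (v : L2 μ), χ v = v → P v = 0 → ‖(S ^ n) v‖ ≤ q ^ n * ‖v‖ := by
    intro n
    induction n with
    | zero => intro v _ _; simp
    | succ n ih =>
      intro v hv hPv
      have h1 : χ (S v) = S v := congrArg (fun T : Op μ => T v) hχS
      have h2 : P (S v) = 0 := by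
        have : P (S v) = P (χ v) := congrArg (fun T : Op μ => T v) hPS
        rw [this, hv, hPv]
      have h3 : ‖S v‖ ≤ q * ‖v‖ := by
        have hnn : 0 ≤ 1 - κ / C' := by
          have : κ / C' ≤ 1 := by rw [div_le_one (by linarith)]; linarith
          linarith
        refine (sq_le_sq₀ (norm_nonneg _) (by positivity)).1 ?_
        rw [mul_pow, Real.sq_sqrt hnn]
        exact hcontr v hv hPv
      calc ‖(S ^ (n + 1)) v‖ = ‖(S ^ n) (S v)‖ := by rw [pow_succ]; rfl
        _ ≤ q ^ n * ‖S v‖ := ih _ h1 h2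
        _ ≤ q ^ n * (q * ‖v‖) := by gcongr
        _ = _ := by ring
  -- By `hPYP` this is a projection. It is fixed by `S`, while the range of `χ - Q` lies in the
  -- kernel of `P`, where `S` contracts; hence `S ^ n * χ` tends to `Q`.
  set Q : Op μ := (s⁻¹ : ℂ) • (χ * P * χ) with hQ
  have hs' : (s : ℂ) ≠ 0 := by exact_mod_cast hs
  have hSQ : ∀ n : ℕ, S ^ n * Q = Q := by
    intro n
    induction n with
    | zero => simp
    | succ n ih =>
      have : S * Q = Q := by
        rw [hQ, mul_smul_comm, ← mul_assoc, hSχP]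
      rw [pow_succ, mul_assoc, this, ih]
  have hχQ : χ * (χ - Q) = χ - Q := by
    rw [mul_sub, hχχ, hQ, mul_smul_comm, ← mul_assoc, ← mul_assoc, hχχ]
  have hPQ : P * (χ - Q) = 0 := by
    rw [mul_sub, hQ, mul_smul_comm, ← mul_assoc, ← mul_assoc, hPYP, smul_mul_assoc, smul_smul,
      inv_mul_cancel₀ hs', one_smul, sub_self]
  have hnorm : ∀ n : ℕ, ‖S ^ n * χ - Q‖ ≤ q ^ n * ‖χ - Q‖ := by
    intro n
    refine ContinuousLinearMap.opNorm_le_bound _ (by positivity) fun f => ?_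
    have h1 : S ^ n * χ - Q = S ^ n * (χ - Q) := by rw [mul_sub, hSQ]
    rw [h1]
    calc _ ≤ q ^ n * ‖(χ - Q) f‖ := hiter n ((χ - Q) f)
          (congrArg (fun T : Op μ => T f) hχQ) (congrArg (fun T : Op μ => T f) hPQ)
      _ ≤ q ^ n * (‖χ - Q‖ * ‖f‖) := by gcongr; exact ContinuousLinearMap.le_opNorm _ _
      _ = _ := by ring
  have hlim : Filter.Tendsto (fun n : ℕ => ‖(s : ℂ)‖ * (q ^ n * ‖χ - Q‖)) Filter.atTop (nhds 0) := by
    have := ((tendsto_pow_atTop_nhds_zero_of_lt_one (Real.sqrt_nonneg _) hq1).mul_const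
      ‖χ - Q‖).const_mul ‖(s : ℂ)‖
    simpa using this
  obtain ⟨n, hn⟩ := (hlim.eventually_lt_const hε).exists
  have hSfp : DynFinitePropagation ℓ S := (dynFinitePropagation_chi hℓ hY).sub (hD.smul _)
  refine ⟨(s : ℂ) • (S ^ n * χ), ((hSfp.pow hℓ n).mul hℓ (dynFinitePropagation_chi hℓ hY)).smul _,
    lt_of_le_of_lt ?_ hn⟩
  have h1 : χ * P * χ = (s : ℂ) • Q := by
    rw [hQ, smul_smul, mul_inv_cancel₀ hs', one_smul]
  rw [h1, ← smul_sub, norm_smul]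
  gcongr
  exact hnorm n

/-- The averaging-type projection `P` is close to its corner on a set `Y` if its corner on `Yᶜ`
is small. -/
theorem norm_chi_mul_mul_chi_sub_le {P : Op μ} (hP : IsSelfAdjoint P) {Y : Set Z}
    (hY : MeasurableSet Y) {b : ℝ} (hb : ‖chi μ hY.compl * P‖ ≤ b) :
    ‖chi μ hY * P * chi μ hY - P‖ ≤ 2 * b := by
  have h1 : chi μ hY = 1 - chi μ hY.compl := eq_sub_of_add_eq (chi_add_chi_compl hY)
  have h2 : ‖P * chi μ hY.compl‖ ≤ b := by
    rw [← norm_star, star_mul, hP, (isSelfAdjoint_chi hY.compl)]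
    exact hb
  have h3 : chi μ hY * P * chi μ hY - P =
      -(chi μ hY * (P * chi μ hY.compl)) - chi μ hY.compl * P := by
    rw [h1]; noncomm_ring
  rw [h3]
  calc _ ≤ ‖chi μ hY * (P * chi μ hY.compl)‖ + ‖chi μ hY.compl * P‖ := by
        refine (norm_sub_le _ _).trans_eq ?_
        rw [norm_neg]
    _ ≤ 1 * b + b := by
        gcongr
        exact (norm_mul_le _ _).trans
          (mul_le_mul (norm_chi_le hY) h2 (norm_nonneg _) zero_le_one)
    _ = 2 * b := by ring

end Propagation

/-! ### Difference operators -/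

section Pull

variable {Z W : Type*} [MeasurableSpace Z] [MeasurableSpace W] {μ : Measure Z} {M : Measure W}

theorem lintegral_comp_le_of_map_le {p : W → Z} (hp : Measurable p) {K : ℝ≥0∞}
    (hK : M.map p ≤ K • μ) {f : Z → ℝ≥0∞} (hf : Measurable f) :
    ∫⁻ w, f (p w) ∂M ≤ K * ∫⁻ z, f z ∂μ := by
  rw [← lintegral_map hf hp, ← smul_eq_mul, ← lintegral_smul_measure]
  exact lintegral_mono' hK le_rfl

theorem quasiMeasurePreserving_of_map_le {p : W → Z} (hp : Measurable p) {K : ℝ≥0∞}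
    (hK : M.map p ≤ K • μ) : Measure.QuasiMeasurePreserving p M μ :=
  ⟨hp, (Measure.absolutelyContinuous_of_le hK).trans Measure.smul_absolutelyContinuous⟩

theorem memLp_comp_of_map_le {p : W → Z} (hp : Measurable p) {K : ℝ≥0∞} (hKtop : K ≠ ∞)
    (hK : M.map p ≤ K • μ) (f : L2 μ) : MemLp (f ∘ p) 2 M := by
  have hf := Lp.stronglyMeasurable f
  refine memLp_two_of_lintegral_lt_top (hf.comp_measurable hp).aestronglyMeasurable ?_
  refine (lintegral_comp_le_of_map_le hp hK (hf.enorm.pow_const 2)).trans_lt ?_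
  exact ENNReal.mul_lt_top hKtop.lt_top (lintegral_enorm_sq_lt_top f)

/-- Composition with `p : W → Z`, as an operator between `L²`-spaces. -/
noncomputable def pull {p : W → Z} (hp : Measurable p) {K : ℝ≥0∞} (hKtop : K ≠ ∞)
    (hK : M.map p ≤ K • μ) : L2 μ →L[ℂ] L2 M :=
  LinearMap.mkContinuous
    { toFun := fun f => (memLp_comp_of_map_le hp hKtop hK f).toLp (f ∘ p)
      map_add' := fun f g => by
        rw [← MemLp.toLp_add, MemLp.toLp_eq_toLp_iff]
        filter_upwards [(quasiMeasurePreserving_of_map_le hp hK).ae (Lp.coeFn_add f g)] with x hx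
        simpa using hx
      map_smul' := fun c f => by
        rw [RingHom.id_apply, ← MemLp.toLp_const_smul, MemLp.toLp_eq_toLp_iff]
        filter_upwards [(quasiMeasurePreserving_of_map_le hp hK).ae (Lp.coeFn_smul c f)] with x hx
        simpa using hx }
    (√K.toReal)
    (fun f => by
      have hf := Lp.stronglyMeasurable f
      set g : L2 M := (memLp_comp_of_map_le hp hKtop hK f).toLp (f ∘ p) with hg
      change ‖g‖ ≤ _
      have h1 : ‖g‖ₑ ^ 2 ≤ K * ‖f‖ₑ ^ 2 := by
        rw [enorm_sq_eq_lintegral, enorm_sq_eq_lintegral]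
        refine le_trans (le_of_eq ?_)
          (lintegral_comp_le_of_map_le hp hK (hf.enorm.pow_const 2))
        refine lintegral_congr_ae ?_
        filter_upwards [(memLp_comp_of_map_le hp hKtop hK f).coeFn_toLp] with w hw
        rw [hw]
        rfl
      rw [← ofReal_norm, ← ofReal_norm, ← ENNReal.ofReal_toReal hKtop,
        ← ENNReal.ofReal_pow (norm_nonneg _), ← ENNReal.ofReal_pow (norm_nonneg _),
        ← ENNReal.ofReal_mul ENNReal.toReal_nonneg,
        ENNReal.ofReal_le_ofReal_iff (by positivity)] at h1
      refine (sq_le_sq₀ (norm_nonneg _) (by positivity)).1 ?_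
      rwa [mul_pow, Real.sq_sqrt ENNReal.toReal_nonneg])

theorem pull_ae {p : W → Z} (hp : Measurable p) {K : ℝ≥0∞} (hKtop : K ≠ ∞)
    (hK : M.map p ≤ K • μ) (f : L2 μ) : pull hp hKtop hK f =ᵐ[M] fun w => f (p w) :=
  (memLp_comp_of_map_le hp hKtop hK f).coeFn_toLp

theorem pull_chi_ae {p : W → Z} (hp : Measurable p) {K : ℝ≥0∞} (hKtop : K ≠ ∞)
    (hK : M.map p ≤ K • μ) {A : Set Z} (hA : MeasurableSet A) (f : L2 μ) :
    pull hp hKtop hK (chi μ hA f) =ᵐ[M] fun w => A.indicator f (p w) := by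
  filter_upwards [pull_ae hp hKtop hK (chi μ hA f),
    (quasiMeasurePreserving_of_map_le hp hK).ae (chi_apply_ae μ hA f)] with w h1 h2
  rw [h1, h2]

/-- The form `f ↦ ∫ |f ∘ p - f ∘ q|²` has finite propagation if `p w` and `q w` are related by
a bounded part of the group. -/
theorem dynFinitePropagation_adjoint_comp_pull_sub {Γ : Type*} [Group Γ] [MulAction Γ Z]
    {ℓ : Γ → ℕ} (hℓ : IsProperLength ℓ) {p q : W → Z} (hp : Measurable p) (hq : Measurable q)
    {K : ℝ≥0∞} (hKtop : K ≠ ∞) (hpK : M.map p ≤ K • μ) (hqK : M.map q ≤ K • μ) {k : ℕ}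
    (hk : ∀ A C : Set Z, MeasurableSet A → MeasurableSet C → μ (ballSMul ℓ k A ∩ C) = 0 →
      M (p ⁻¹' A ∩ q ⁻¹' C) = 0 ∧ M (q ⁻¹' A ∩ p ⁻¹' C) = 0) :
    DynFinitePropagation ℓ (ContinuousLinearMap.adjoint (pull hp hKtop hpK - pull hq hKtop hqK) ∘L
      (pull hp hKtop hpK - pull hq hKtop hqK)) := by
  refine ⟨k, fun A C hA hC hAC => ?_⟩
  obtain ⟨h1, h2⟩ := hk A C hA hC hAC
  have h3 : μ (A ∩ C) = 0 :=
    measure_mono_null (inter_subset_inter_left _ (subset_ballSMul hℓ k A)) hAC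
  have hpq := (quasiMeasurePreserving_of_map_le hp hpK).ae (measure_eq_zero_iff_ae_notMem.1 h3)
  have hqq := (quasiMeasurePreserving_of_map_le hq hqK).ae (measure_eq_zero_iff_ae_notMem.1 h3)
  set D := pull hp hKtop hpK - pull hq hKtop hqK
  refine ContinuousLinearMap.ext fun f => ext_inner_left ℂ fun g => ?_
  simp only [ContinuousLinearMap.comp_apply, _root_.zero_apply, inner_zero_right]
  -- The matrix coefficient is `⟨D χ_A g, D χ_C f⟩`. Its integrand can be nonzero only where `p w`
  -- or `q w` lies in `A` and `p w` or `q w` lies in `C`, a null set.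
  rw [← inner_chi_left, ContinuousLinearMap.adjoint_inner_right, L2.inner_def]
  refine integral_eq_zero_of_ae ?_
  have hDA : D (chi μ hA g) =ᵐ[M] fun w => A.indicator g (p w) - A.indicator g (q w) := by
    filter_upwards [Lp.coeFn_sub (pull hp hKtop hpK (chi μ hA g)) (pull hq hKtop hqK (chi μ hA g)),
      pull_chi_ae hp hKtop hpK hA g, pull_chi_ae hq hKtop hqK hA g] with w e1 e2 e3
    rw [_root_.sub_apply, e1, Pi.sub_apply, e2, e3]
  have hDC : D (chi μ hC f) =ᵐ[M] fun w => C.indicator f (p w) - C.indicator f (q w) := by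
    filter_upwards [Lp.coeFn_sub (pull hp hKtop hpK (chi μ hC f)) (pull hq hKtop hqK (chi μ hC f)),
      pull_chi_ae hp hKtop hpK hC f, pull_chi_ae hq hKtop hqK hC f] with w e1 e2 e3
    rw [_root_.sub_apply, e1, Pi.sub_apply, e2, e3]
  filter_upwards [hDA, hDC, hpq, hqq, measure_eq_zero_iff_ae_notMem.1 h1,
    measure_eq_zero_iff_ae_notMem.1 h2] with w e1 e2 n1 n2 n3 n4
  rw [e1, e2]
  simp only [mem_inter_iff, mem_preimage, not_and] at n1 n2 n3 n4
  by_cases hpA : p w ∈ A <;> by_cases hqA : q w ∈ A <;> by_cases hpC : p w ∈ C <;>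
    by_cases hqC : q w ∈ C <;> simp_all

end Pull

/-! ### From expansion to a Poincaré inequality -/

section Poincare

/-- The positive part of `a - b` is the length of `[b, a)`; apply Tonelli. With `a` and `b` the
values of a function at the two ends of an edge, this is the co-area formula. -/
theorem lintegral_ofReal_sub_eq {W : Type*} [MeasurableSpace W] (M : Measure W) [SFinite M]
    {a b : W → ℝ} (ha : Measurable a) (hb : Measurable b) :
    ∫⁻ w, ENNReal.ofReal (a w - b w) ∂M = ∫⁻ s : ℝ, M {w | b w ≤ s ∧ s < a w} := by
  have hE : MeasurableSet {z : W × ℝ | b z.1 ≤ z.2 ∧ z.2 < a z.1} :=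
    (measurableSet_le (hb.comp measurable_fst) measurable_snd).inter
      (measurableSet_lt measurable_snd (ha.comp measurable_fst))
  have h1 := Measure.prod_apply (μ := M) (ν := (volume : Measure ℝ)) hE
  have h2 := Measure.prod_apply_symm (μ := M) (ν := (volume : Measure ℝ)) hE
  rw [h2] at h1
  refine Eq.trans ?_ h1.symm
  refine lintegral_congr fun w => ?_
  rw [← Real.volume_Ico]
  rfl

theorem lintegral_ofReal_abs_sub_eq {W : Type*} [MeasurableSpace W] (M : Measure W) [SFinite M]
    {a b : W → ℝ} (ha : Measurable a) (hb : Measurable b) :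
    ∫⁻ w, ENNReal.ofReal |a w - b w| ∂M =
      ∫⁻ s : ℝ, (M {w | b w ≤ s ∧ s < a w} + M {w | a w ≤ s ∧ s < b w}) := by
  have h1 : ∀ w, ENNReal.ofReal |a w - b w| =
      ENNReal.ofReal (a w - b w) + ENNReal.ofReal (b w - a w) := fun w => by
    rcases le_total (a w) (b w) with h | h
    · rw [abs_of_nonpos (by linarith), ENNReal.ofReal_of_nonpos (by linarith : a w - b w ≤ 0),
        zero_add, neg_sub]
    · rw [abs_of_nonneg (by linarith), ENNReal.ofReal_of_nonpos (by linarith : b w - a w ≤ 0),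
        add_zero]
  have hE : MeasurableSet {z : ℝ × W | b z.2 ≤ z.1 ∧ z.1 < a z.2} :=
    (measurableSet_le (hb.comp measurable_snd) measurable_fst).inter
      (measurableSet_lt measurable_fst (ha.comp measurable_snd))
  simp_rw [h1]
  rw [lintegral_add_left (by fun_prop), lintegral_ofReal_sub_eq M ha hb,
    lintegral_ofReal_sub_eq M hb ha]
  exact (lintegral_add_left (measurable_measure_prodMk_left hE) _).symm

/-- The signed square `a |a|` is monotone, so its level sets are those of `a`, and no splitting at a
median is needed. For equal signs `|a² - b²| ≥ (a - b)²`; for opposite signs `2(a² + b²) ≥ (a -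
b)²`. -/
theorem sq_sub_le_two_mul_abs (a b : ℝ) : (a - b) ^ 2 ≤ 2 * |(a * |a| - b * |b|)| := by
  rcases le_total 0 a with ha | ha <;> rcases le_total 0 b with hb | hb
  · rw [abs_of_nonneg ha, abs_of_nonneg hb]
    rcases le_total a b with h | h
    · rw [abs_of_nonpos (by nlinarith)]; nlinarith
    · rw [abs_of_nonneg (by nlinarith)]; nlinarith
  · rw [abs_of_nonneg ha, abs_of_nonpos hb, abs_of_nonneg (by nlinarith)]
    nlinarith [sq_nonneg (a + b)]
  · rw [abs_of_nonpos ha, abs_of_nonneg hb, abs_of_nonpos (by nlinarith)]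
    nlinarith [sq_nonneg (a + b)]
  · rw [abs_of_nonpos ha, abs_of_nonpos hb]
    rcases le_total a b with h | h
    · rw [abs_of_nonpos (by nlinarith)]; nlinarith
    · rw [abs_of_nonneg (by nlinarith)]; nlinarith

theorem abs_mul_abs_sub_le (a b : ℝ) : |(a * |a| - b * |b|)| ≤ |a - b| * (|a| + |b|) := by
  have h1 : a * |a| - b * |b| = (a - b) * |a| + b * (|a| - |b|) := by ring
  have h2 := abs_abs_sub_abs_le_abs_sub a b
  calc |(a * |a| - b * |b|)| ≤ |((a - b) * |a|)| + |b * (|a| - |b|)| := by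
        rw [h1]; exact abs_add_le _ _
    _ = |a - b| * |a| + |b| * |(|a| - |b|)| := by rw [abs_mul, abs_mul, abs_abs]
    _ ≤ |a - b| * |a| + |b| * |a - b| := by gcongr
    _ = _ := by ring

/-- Weighted AM–GM: the free parameter `τ` later makes the `a ² + b ²` part small enough to absorb.
-/
theorem abs_mul_abs_sub_le_of_pos (a b : ℝ) {τ : ℝ} (hτ : 0 < τ) :
    |(a * |a| - b * |b|)| ≤ τ * (a - b) ^ 2 + 1 / (2 * τ) * (a ^ 2 + b ^ 2) := by
  refine (abs_mul_abs_sub_le a b).trans ?_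
  have h1 : 0 ≤ (2 * τ * |a - b| - (|a| + |b|)) ^ 2 := sq_nonneg _
  have h2 : 0 ≤ (|a| - |b|) ^ 2 := sq_nonneg _
  have ea := sq_abs a
  have eb := sq_abs b
  have eab := sq_abs (a - b)
  have h3 : τ * (a - b) ^ 2 + 1 / (2 * τ) * (a ^ 2 + b ^ 2) - |a - b| * (|a| + |b|) =
      ((2 * τ * |a - b| - (|a| + |b|)) ^ 2 + (|a| - |b|) ^ 2) / (4 * τ) := by
    rw [← ea, ← eb, ← eab]
    field_simp
    ring
  have h4 : 0 ≤ ((2 * τ * |a - b| - (|a| + |b|)) ^ 2 + (|a| - |b|) ^ 2) / (4 * τ) := by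
    positivity
  linarith

variable {X : Type*} [MeasurableSpace X]

/-- For mean zero the cross term vanishes, so subtracting `c` only adds `c²` times the total mass.
-/
theorem lintegral_sq_le_lintegral_sub_sq {η : Measure X} [IsFiniteMeasure η] {u : X → ℝ}
    (hu : MemLp u 2 η) (h0 : ∫ x, u x ∂η = 0) (c : ℝ) :
    ∫⁻ x, ENNReal.ofReal (u x ^ 2) ∂η ≤ ∫⁻ x, ENNReal.ofReal ((u x - c) ^ 2) ∂η := by
  have h1 : Integrable u η := hu.integrable (by norm_num)
  have h2 : Integrable (fun x => u x ^ 2) η := hu.integrable_sq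
  have h3 : Integrable (fun x => (u x - c) ^ 2) η := (hu.sub (memLp_const c)).integrable_sq
  rw [← ofReal_integral_eq_lintegral_ofReal h2 (ae_of_all _ fun x => sq_nonneg _),
    ← ofReal_integral_eq_lintegral_ofReal h3 (ae_of_all _ fun x => sq_nonneg _)]
  refine ENNReal.ofReal_le_ofReal ?_
  have e : ∀ x, (u x - c) ^ 2 = u x ^ 2 - 2 * c * u x + c ^ 2 := fun x => by ring
  simp_rw [e]
  have h4 : Integrable (fun x => u x ^ 2 - 2 * c * u x) η := h2.sub (h1.const_mul _)
  rw [integral_add h4 (integrable_const _),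
    integral_sub h2 (h1.const_mul _), integral_const_mul, h0, integral_const]
  have : 0 ≤ η.real univ • c ^ 2 := by
    rw [smul_eq_mul]; exact mul_nonneg measureReal_nonneg (sq_nonneg c)
  linarith

/-- Cheeger's inequality for real functions of mean zero. -/
theorem poincare_real {η : Measure X} [IsFiniteMeasure η] {m : Measure (X × X)} [SFinite m]
    {C K : ℝ} (hC : 0 < C) (hK : 0 < K) (hη : 0 < η.real univ)
    (hfst : m.map Prod.fst ≤ ENNReal.ofReal K • η) (hsnd : m.map Prod.snd ≤ ENNReal.ofReal K • η)
    (hexp : ∀ A : Set X, MeasurableSet A →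
      η A * η Aᶜ ≤ ENNReal.ofReal C * (m (A ×ˢ Aᶜ) + m (Aᶜ ×ˢ A)))
    {u : X → ℝ} (hu : Measurable u) (hu2 : MemLp u 2 η) (h0 : ∫ x, u x ∂η = 0) :
    ∫⁻ x, ENNReal.ofReal (u x ^ 2) ∂η ≤ ENNReal.ofReal (64 * C ^ 2 * K / η.real univ ^ 2) *
      ∫⁻ z, ENNReal.ofReal ((u z.1 - u z.2) ^ 2) ∂m := by
  set e : ℝ := η.real univ with he
  set φ : X → ℝ := fun x => u x * |u x| with hφ
  have hφm : Measurable φ := hu.mul hu.abs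
  set I := ∫⁻ x, ENNReal.ofReal (u x ^ 2) ∂η with hI
  set E := ∫⁻ z, ENNReal.ofReal ((u z.1 - u z.2) ^ 2) ∂m with hE
  have hu1 : Measurable fun z : X × X => u z.1 := hu.comp measurable_fst
  have hu2' : Measurable fun z : X × X => u z.2 := hu.comp measurable_snd
  have hφ1 : Measurable fun z : X × X => φ z.1 := hφm.comp measurable_fst
  have hφ2 : Measurable fun z : X × X => φ z.2 := hφm.comp measurable_snd
  have hIfin : I ≠ ∞ := by
    have h2 : Integrable (fun x => u x ^ 2) η := hu2.integrable_sq
    rw [hI, ← ofReal_integral_eq_lintegral_ofReal h2 (ae_of_all _ fun x => sq_nonneg _)]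
    exact ENNReal.ofReal_ne_top
  -- Take the constant `c = u y` in the preceding inequality and integrate over `y`.
  have step1 : ENNReal.ofReal e * I ≤
      ∫⁻ z, ENNReal.ofReal ((u z.1 - u z.2) ^ 2) ∂(η.prod η) := by
    rw [lintegral_prod_symm _ (by fun_prop)]
    calc ENNReal.ofReal e * I = ∫⁻ _, I ∂η := by
          rw [lintegral_const, he, ofReal_measureReal, mul_comm]
      _ ≤ _ := lintegral_mono fun y => lintegral_sq_le_lintegral_sub_sq hu2 h0 (u y)
  have step2 : ∫⁻ z, ENNReal.ofReal ((u z.1 - u z.2) ^ 2) ∂(η.prod η) ≤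
      2 * ∫⁻ z, ENNReal.ofReal |φ z.1 - φ z.2| ∂(η.prod η) := by
    rw [← lintegral_const_mul _ (by fun_prop)]
    refine lintegral_mono fun z => ?_
    rw [← ENNReal.ofReal_ofNat 2, ← ENNReal.ofReal_mul (by norm_num)]
    exact ENNReal.ofReal_le_ofReal (sq_sub_le_two_mul_abs _ _)
  -- By the co-area formula both sides are integrals over levels `s`, and `hexp` compares them for
  -- the set `{φ > s}`. The factor `2` counts both orientations.
  have step3 : ∫⁻ z, ENNReal.ofReal |φ z.1 - φ z.2| ∂(η.prod η) ≤
      ENNReal.ofReal (2 * C) * ∫⁻ z, ENNReal.ofReal |φ z.1 - φ z.2| ∂m := by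
    rw [lintegral_ofReal_abs_sub_eq _ hφ1 hφ2, lintegral_ofReal_abs_sub_eq _ hφ1 hφ2,
      ← lintegral_const_mul' _ _ ENNReal.ofReal_ne_top]
    refine lintegral_mono fun s => ?_
    have hA : MeasurableSet {x | s < φ x} := measurableSet_lt measurable_const hφm
    have e1 : {z : X × X | φ z.2 ≤ s ∧ s < φ z.1} = {x | s < φ x} ×ˢ {x | s < φ x}ᶜ := by
      ext z; simp [and_comm]
    have e2 : {z : X × X | φ z.1 ≤ s ∧ s < φ z.2} = {x | s < φ x}ᶜ ×ˢ {x | s < φ x} := by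
      ext z; simp
    rw [e1, e2, Measure.prod_prod, Measure.prod_prod, mul_comm (η {x | s < φ x}ᶜ), ← two_mul,
      ENNReal.ofReal_mul (by norm_num), ENNReal.ofReal_ofNat, mul_assoc]
    exact mul_le_mul_right (hexp _ hA) 2
  -- Chosen so that the mass term `2 · 2C · (K / τ) I` equals `(e / 2) I`, half of the left side,
  -- and can be absorbed because `I` is finite.
  set τ : ℝ := 8 * C * K / e with hτ
  have hτ0 : 0 < τ := by positivity
  have step4 : ∫⁻ z, ENNReal.ofReal |φ z.1 - φ z.2| ∂m ≤
      ENNReal.ofReal τ * E + ENNReal.ofReal (K / τ) * I := by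
    have hsq : Measurable fun x => ENNReal.ofReal (u x ^ 2) := (hu.pow_const 2).ennreal_ofReal
    have b1 := lintegral_comp_le_of_map_le measurable_fst hfst hsq
    have b2 := lintegral_comp_le_of_map_le measurable_snd hsnd hsq
    calc ∫⁻ z, ENNReal.ofReal |φ z.1 - φ z.2| ∂m
        ≤ ∫⁻ z, (ENNReal.ofReal τ * ENNReal.ofReal ((u z.1 - u z.2) ^ 2) +
            ENNReal.ofReal (1 / (2 * τ)) *
              (ENNReal.ofReal (u z.1 ^ 2) + ENNReal.ofReal (u z.2 ^ 2))) ∂m := by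
          refine lintegral_mono fun z => ?_
          rw [← ENNReal.ofReal_add (sq_nonneg _) (sq_nonneg _), ← ENNReal.ofReal_mul hτ0.le,
            ← ENNReal.ofReal_mul (by positivity), ← ENNReal.ofReal_add (by positivity)
              (by positivity)]
          exact ENNReal.ofReal_le_ofReal (abs_mul_abs_sub_le_of_pos _ _ hτ0)
      _ = ENNReal.ofReal τ * E + ENNReal.ofReal (1 / (2 * τ)) *
            (∫⁻ z, ENNReal.ofReal (u z.1 ^ 2) ∂m + ∫⁻ z, ENNReal.ofReal (u z.2 ^ 2) ∂m) := by
          rw [lintegral_add_left (by fun_prop), lintegral_const_mul _ (by fun_prop),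
            lintegral_const_mul _ (by fun_prop), lintegral_add_left (by fun_prop)]
      _ ≤ ENNReal.ofReal τ * E + ENNReal.ofReal (1 / (2 * τ)) *
            (ENNReal.ofReal K * I + ENNReal.ofReal K * I) := by gcongr
      _ = _ := by
          rw [← two_mul, ← mul_assoc, ← mul_assoc, ← ENNReal.ofReal_ofNat 2,
            ← ENNReal.ofReal_mul (by positivity), ← ENNReal.ofReal_mul (by positivity)]
          congr 3
          field_simp
  rcases eq_or_ne E ∞ with hEtop | hEfin
  · rw [hEtop, ENNReal.mul_top (by simpa using by positivity)]
    exact le_top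
  have total : ENNReal.ofReal e * I ≤ 2 * (ENNReal.ofReal (2 * C) *
      (ENNReal.ofReal τ * E + ENNReal.ofReal (K / τ) * I)) :=
    step1.trans (step2.trans (mul_le_mul_right (step3.trans (mul_le_mul_right step4 _)) _))
  rw [← ENNReal.ofReal_toReal hIfin, ← ENNReal.ofReal_toReal hEfin] at total ⊢
  have hI0 : 0 ≤ I.toReal := ENNReal.toReal_nonneg
  have hE0 : 0 ≤ E.toReal := ENNReal.toReal_nonneg
  rw [← ENNReal.ofReal_mul hη.le, ← ENNReal.ofReal_mul hτ0.le,
    ← ENNReal.ofReal_mul (by positivity), ← ENNReal.ofReal_add (by positivity) (by positivity),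
    ← ENNReal.ofReal_mul (by positivity), ← ENNReal.ofReal_ofNat 2,
    ← ENNReal.ofReal_mul (by positivity), ENNReal.ofReal_le_ofReal_iff (by positivity)] at total
  rw [← ENNReal.ofReal_mul (by positivity)]
  refine ENNReal.ofReal_le_ofReal ?_
  have h5 : K / τ = e / (8 * C) := by rw [hτ]; field_simp
  rw [h5] at total
  have h6 : 2 * (2 * C * (τ * E.toReal + e / (8 * C) * I.toReal)) =
      4 * C * τ * E.toReal + e / 2 * I.toReal := by field_simp; ring
  rw [h6] at total
  have h7 : 64 * C ^ 2 * K / e ^ 2 * E.toReal = (4 * C * τ * E.toReal) / (e / 2) := by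
    rw [hτ]; field_simp; ring
  rw [h7, le_div_iff₀ (by positivity)]
  linarith

theorem enorm_sq_complex (z : ℂ) :
    ‖z‖ₑ ^ 2 = ENNReal.ofReal (z.re ^ 2) + ENNReal.ofReal (z.im ^ 2) := by
  rw [← ofReal_norm, ← ENNReal.ofReal_pow (norm_nonneg _),
    ← ENNReal.ofReal_add (sq_nonneg _) (sq_nonneg _), Complex.sq_norm, Complex.normSq_apply]
  ring_nf

/-- Cheeger's inequality for complex functions of mean zero. -/
theorem poincare_complex {η : Measure X} [IsFiniteMeasure η] {m : Measure (X × X)} [SFinite m]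
    {C K : ℝ} (hC : 0 < C) (hK : 0 < K) (hη : 0 < η.real univ)
    (hfst : m.map Prod.fst ≤ ENNReal.ofReal K • η) (hsnd : m.map Prod.snd ≤ ENNReal.ofReal K • η)
    (hexp : ∀ A : Set X, MeasurableSet A →
      η A * η Aᶜ ≤ ENNReal.ofReal C * (m (A ×ˢ Aᶜ) + m (Aᶜ ×ˢ A)))
    {f : X → ℂ} (hf : Measurable f) (hf2 : MemLp f 2 η) (h0 : ∫ x, f x ∂η = 0) :
    ∫⁻ x, ‖f x‖ₑ ^ 2 ∂η ≤ ENNReal.ofReal (64 * C ^ 2 * K / η.real univ ^ 2) *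
      ∫⁻ z, ‖f z.1 - f z.2‖ₑ ^ 2 ∂m := by
  have hre : Measurable fun x => (f x).re := Complex.measurable_re.comp hf
  have him : Measurable fun x => (f x).im := Complex.measurable_im.comp hf
  have hint : Integrable f η := hf2.integrable (by norm_num)
  have h0re : ∫ x, (f x).re ∂η = 0 := by
    have := integral_re (𝕜 := ℂ) hint
    rw [h0] at this
    simpa using this
  have h0im : ∫ x, (f x).im ∂η = 0 := by
    have := integral_im (𝕜 := ℂ) hint
    rw [h0] at this
    simpa using this
  have r1 := poincare_real hC hK hη hfst hsnd hexp hre (MemLp.re hf2) h0re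
  have r2 := poincare_real hC hK hη hfst hsnd hexp him (MemLp.im hf2) h0im
  simp_rw [enorm_sq_complex, Complex.sub_re, Complex.sub_im]
  rw [lintegral_add_left (by fun_prop), lintegral_add_left (by fun_prop), mul_add]
  exact add_le_add r1 r2

end Poincare

/-! ### Maximal sets and expanding domains -/

section Maximal

variable {X : Type*} [MeasurableSpace X]

/-- A property of measurable sets that is closed under increasing unions has an element which
is maximal up to null sets. -/
theorem exists_maximal_measure (ν : Measure X) [IsFiniteMeasure ν] (p : Set X → Prop)
    (hempty : p ∅) (hunion : ∀ F : ℕ → Set X, (∀ n, MeasurableSet (F n)) → Monotone F →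
      (∀ n, p (F n)) → p (⋃ n, F n)) :
    ∃ F : Set X, MeasurableSet F ∧ p F ∧
      ∀ G : Set X, MeasurableSet G → p G → F ⊆ G → ν.real G ≤ ν.real F := by
  -- Each step goes at least half way from the current measure to the supremum over admissible
  -- supersets; in the limit nothing is left to gain.
  have next : ∀ F : {F : Set X // MeasurableSet F ∧ p F}, ∃ F' : {F : Set X // MeasurableSet F ∧ p F},
      F.1 ⊆ F'.1 ∧ ∀ G : Set X, MeasurableSet G → p G → F.1 ⊆ G →
        ν.real G + ν.real F.1 ≤ 2 * ν.real F'.1 := by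
    rintro ⟨F, hF, hpF⟩
    set V : Set ℝ := {r | ∃ G : Set X, MeasurableSet G ∧ p G ∧ F ⊆ G ∧ r = ν.real G} with hV
    have hbdd : BddAbove V := ⟨ν.real univ, by
      rintro _ ⟨G, -, -, -, rfl⟩
      exact measureReal_mono (subset_univ G)⟩
    have hFV : ν.real F ∈ V := ⟨F, hF, hpF, Subset.rfl, rfl⟩
    have hle : ν.real F ≤ sSup V := le_csSup hbdd hFV
    rcases hle.eq_or_lt with h | h
    · refine ⟨⟨F, hF, hpF⟩, Subset.rfl, fun G hG hpG hFG => ?_⟩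
      have := le_csSup hbdd ⟨G, hG, hpG, hFG, rfl⟩
      dsimp only
      linarith
    · obtain ⟨_, ⟨F', hF', hpF', hFF', rfl⟩, hlt⟩ := exists_lt_of_lt_csSup ⟨_, hFV⟩
        (show (ν.real F + sSup V) / 2 < sSup V by linarith)
      refine ⟨⟨F', hF', hpF'⟩, hFF', fun G hG hpG hFG => ?_⟩
      have := le_csSup hbdd ⟨G, hG, hpG, hFG, rfl⟩
      dsimp only
      linarith
  choose step hsub hstep using next
  let F : ℕ → {F : Set X // MeasurableSet F ∧ p F} := fun n =>
    step^[n] ⟨∅, MeasurableSet.empty, hempty⟩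
  have hsucc : ∀ n, F (n + 1) = step (F n) := fun n => Function.iterate_succ_apply' _ _ _
  have hmono : Monotone fun n => (F n).1 := monotone_nat_of_le_succ fun n => by
    rw [hsucc]; exact hsub _
  refine ⟨⋃ n, (F n).1, .iUnion fun n => (F n).2.1,
    hunion _ (fun n => (F n).2.1) hmono fun n => (F n).2.2, fun G hG hpG hFG => ?_⟩
  have hlim : Filter.Tendsto (fun n => ν.real (F n).1) Filter.atTop
      (nhds (ν.real (⋃ n, (F n).1))) :=
    (ENNReal.tendsto_toReal (measure_ne_top _ _)).comp (tendsto_measure_iUnion_atTop hmono)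
  have hlim1 := (hlim.comp (Filter.tendsto_add_atTop_nat 1)).const_mul 2
  have := le_of_tendsto_of_tendsto' (hlim.const_add (ν.real G)) hlim1 fun n => by
    have := hstep (F n) G hG hpG ((subset_iUnion (fun n => (F n).1) n).trans hFG)
    simpa [hsucc] using this
  linarith

/-- The size of the boundary of `A` with respect to a measure `m` on the set of edges. -/
noncomputable def edgeBoundary (m : Measure (X × X)) (A : Set X) : ℝ :=
  m.real (A ×ˢ Aᶜ) + m.real (Aᶜ ×ˢ A)

/-- The complement of the union is contained in that of each `F n`. Holding this complement fixed
leaves increasing sets of edges, to which continuity from below applies. -/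
theorem edgeBoundary_iUnion_le (m : Measure (X × X)) [IsFiniteMeasure m] (ν : Measure X)
    [IsFiniteMeasure ν] {c : ℝ} {F : ℕ → Set X} (hmono : Monotone F)
    (h : ∀ n, edgeBoundary m (F n) ≤ c * ν.real (F n)) :
    edgeBoundary m (⋃ n, F n) ≤ c * ν.real (⋃ n, F n) := by
  have hlim : ∀ {Z : Type _} [MeasurableSpace Z] (μ : Measure Z) [IsFiniteMeasure μ]
      {s : ℕ → Set Z}, Monotone s →
      Filter.Tendsto (fun n => μ.real (s n)) Filter.atTop (nhds (μ.real (⋃ n, s n))) :=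
    fun μ _ s hs =>
      (ENNReal.tendsto_toReal (measure_ne_top _ _)).comp (tendsto_measure_iUnion_atTop hs)
  have h1 := hlim m (s := fun n => F n ×ˢ (⋃ n, F n)ᶜ)
    fun i j hij => prod_mono (hmono hij) Subset.rfl
  have h2 := hlim m (s := fun n => (⋃ n, F n)ᶜ ×ˢ F n)
    fun i j hij => prod_mono Subset.rfl (hmono hij)
  rw [← iUnion_prod_const] at h1
  rw [← prod_iUnion] at h2
  have h3 : Filter.Tendsto (fun n => ν.real (F n)) Filter.atTop (nhds (ν.real (⋃ n, F n))) :=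
    (ENNReal.tendsto_toReal (measure_ne_top _ _)).comp (tendsto_measure_iUnion_atTop hmono)
  refine le_of_tendsto_of_tendsto' (h1.add h2) (h3.const_mul c) fun n => le_trans ?_ (h n)
  have hc : (⋃ n, F n)ᶜ ⊆ (F n)ᶜ := compl_subset_compl.2 (subset_iUnion F n)
  exact add_le_add (measureReal_mono (prod_mono Subset.rfl hc))
    (measureReal_mono (prod_mono hc Subset.rfl))

/-- A boundary edge of the union either joins `F` to its complement, or lies wholly outside `F` and
joins `A` to its complement. -/
theorem edgeBoundary_union_le (m : Measure (X × X)) [IsFiniteMeasure m] {F A : Set X} :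
    edgeBoundary m (F ∪ (A ∩ Fᶜ)) ≤ edgeBoundary m F +
      edgeBoundary (m.restrict (Fᶜ ×ˢ Fᶜ)) A := by
  have hr : ∀ S : Set (X × X), m.real (S ∩ Fᶜ ×ˢ Fᶜ) ≤ (m.restrict (Fᶜ ×ˢ Fᶜ)).real S := fun S =>
    ENNReal.toReal_mono (measure_ne_top _ _) (Measure.le_restrict_apply _ _)
  have hG : (F ∪ (A ∩ Fᶜ))ᶜ = Aᶜ ∩ Fᶜ := by
    ext x; by_cases h : x ∈ F <;> simp [h]
  have h1 : m.real ((F ∪ (A ∩ Fᶜ)) ×ˢ (F ∪ (A ∩ Fᶜ))ᶜ) ≤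
      m.real (F ×ˢ Fᶜ) + m.real ((A ×ˢ Aᶜ) ∩ Fᶜ ×ˢ Fᶜ) := by
    rw [hG]
    refine (measureReal_mono ?_).trans (measureReal_union_le _ _)
    rintro ⟨x, y⟩ ⟨hx | hx, hy⟩
    · exact Or.inl ⟨hx, hy.2⟩
    · exact Or.inr ⟨⟨hx.1, hy.1⟩, hx.2, hy.2⟩
  have h2 : m.real ((F ∪ (A ∩ Fᶜ))ᶜ ×ˢ (F ∪ (A ∩ Fᶜ))) ≤
      m.real (Fᶜ ×ˢ F) + m.real ((Aᶜ ×ˢ A) ∩ Fᶜ ×ˢ Fᶜ) := by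
    rw [hG]
    refine (measureReal_mono ?_).trans (measureReal_union_le _ _)
    rintro ⟨x, y⟩ ⟨hx, hy | hy⟩
    · exact Or.inl ⟨hx.2, hy⟩
    · exact Or.inr ⟨⟨hx.1, hy.1⟩, hx.2, hy.2⟩
  unfold edgeBoundary
  linarith [hr (A ×ˢ Aᶜ), hr (Aᶜ ×ˢ A)]

/-- If medium-sized sets have large boundary, then all sets have proportionally large boundary
inside a suitable domain of almost full measure. -/
theorem exists_expanding_domain (ν : Measure X) [IsProbabilityMeasure ν] (m : Measure (X × X))
    [IsFiniteMeasure m] {α c₀ : ℝ} (hα : 0 < α) (hα3 : α ≤ 1 / 3) (hc₀ : 0 < c₀)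
    (h : ∀ A : Set X, MeasurableSet A → α ≤ ν.real A → ν.real A ≤ 1 - α →
      c₀ ≤ edgeBoundary m A) :
    ∃ Y : Set X, MeasurableSet Y ∧ ν.real Yᶜ < α ∧ ∃ C : ℝ, 0 < C ∧
      ∀ A : Set X, MeasurableSet A → ν.real (A ∩ Y) * ν.real (Aᶜ ∩ Y) ≤
        C * edgeBoundary (m.restrict (Y ×ˢ Y)) A := by
  set c := c₀ / 2 with hc
  have hc0 : 0 < c := half_pos hc₀
  obtain ⟨F, hF, ⟨hF2, hFc⟩, hmax⟩ := exists_maximal_measure ν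
    (fun F => ν.real F ≤ 1 / 2 ∧ edgeBoundary m F ≤ c * ν.real F) (by simp [edgeBoundary])
    (fun F _ hmono hp => ⟨by
      have := (ENNReal.tendsto_toReal (measure_ne_top ν _)).comp
        (tendsto_measure_iUnion_atTop hmono)
      exact le_of_tendsto' this fun n => (hp n).1,
      edgeBoundary_iUnion_le m ν hmono fun n => (hp n).2⟩)
  have hsmall : ∀ A : Set X, MeasurableSet A → ν.real A ≤ 1 - α →
      edgeBoundary m A ≤ c * ν.real A → ν.real A < α := by
    intro A hA hA1 hAc
    by_contra! hαA
    have h1 := h A hA hαA hA1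
    have h2 : ν.real A ≤ 1 := measureReal_le_one
    nlinarith
  have hFα : ν.real F < α := hsmall F hF (by linarith) hFc
  refine ⟨Fᶜ, hF.compl, by rwa [compl_compl], 1 / c, by positivity, ?_⟩
  -- A violating piece of `Fᶜ` could be added to `F` without spoiling its boundary bound, against
  -- maximality of `F`.
  have key : ∀ A : Set X, MeasurableSet A → ν.real (A ∩ Fᶜ) ≤ ν.real (Aᶜ ∩ Fᶜ) →
      c * ν.real (A ∩ Fᶜ) ≤ edgeBoundary (m.restrict (Fᶜ ×ˢ Fᶜ)) A := by
    intro A hA hle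
    by_contra! hlt
    have hAF : MeasurableSet (A ∩ Fᶜ) := hA.inter hF.compl
    have h1 : ν.real (A ∩ Fᶜ) + ν.real (Aᶜ ∩ Fᶜ) = 1 - ν.real F := by
      rw [← probReal_compl_eq_one_sub hF, inter_comm, inter_comm Aᶜ, ← sdiff_eq,
        measureReal_inter_add_sdiff hA]
    have h2 : ν.real (F ∪ (A ∩ Fᶜ)) = ν.real F + ν.real (A ∩ Fᶜ) :=
      measureReal_union (disjoint_compl_right.mono_right inter_subset_right) hAF
    have h3 := edgeBoundary_union_le m (F := F) (A := A)
    have h4 : edgeBoundary m (F ∪ (A ∩ Fᶜ)) ≤ c * ν.real (F ∪ (A ∩ Fᶜ)) := by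
      rw [h2]; linarith
    -- The enlarged set has measure at most `(1 + ν(F)) / 2 < (1 + α) / 2`, which is at most `1 - α`
    -- because `α ≤ 1 / 3`.
    have h5 := hsmall _ (hF.union hAF) (by linarith) h4
    have h6 := hmax _ (hF.union hAF) ⟨by linarith, h4⟩ subset_union_left
    have h7 : 0 ≤ edgeBoundary (m.restrict (Fᶜ ×ˢ Fᶜ)) A :=
      add_nonneg measureReal_nonneg measureReal_nonneg
    nlinarith
  intro A hA
  rw [one_div, inv_mul_eq_div, le_div_iff₀ hc0]
  have b1 : ν.real (A ∩ Fᶜ) ≤ 1 := measureReal_le_one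
  have b2 : ν.real (Aᶜ ∩ Fᶜ) ≤ 1 := measureReal_le_one
  have n1 : 0 ≤ ν.real (A ∩ Fᶜ) := measureReal_nonneg
  have n2 : 0 ≤ ν.real (Aᶜ ∩ Fᶜ) := measureReal_nonneg
  rcases le_total (ν.real (A ∩ Fᶜ)) (ν.real (Aᶜ ∩ Fᶜ)) with hle | hle
  · have := key A hA hle
    nlinarith [mul_nonneg n1 hc0.le]
  · have h1 := key Aᶜ hA.compl (by rwa [compl_compl])
    have h2 : edgeBoundary (m.restrict (Fᶜ ×ˢ Fᶜ)) Aᶜ =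
        edgeBoundary (m.restrict (Fᶜ ×ˢ Fᶜ)) A := by
      rw [edgeBoundary, edgeBoundary, compl_compl, add_comm]
    rw [h2] at h1
    nlinarith [mul_nonneg n2 hc0.le]

end Maximal

/-! ### The edge measure of a measure-class-preserving action -/

section EdgeMeasure

variable {Γ X : Type*} [Group Γ] [MulAction Γ X] [MeasurableSpace X] [MeasurableConstSMul Γ X]
  {ℓ : Γ → ℕ} {ν : Measure X}

/-- Take the density `min(1, d(γ_*ν)/dν)` against `ν`; it is positive almost everywhere because the
action preserves null sets. The minorant is what keeps both ends of an edge bounded by `ν` when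
Radon–Nikodym derivatives are unbounded. -/
theorem exists_common_minorant [IsFiniteMeasure ν] (h : MeasureClassPreserving Γ ν) (γ : Γ) :
    ∃ σ : Measure X, σ ≤ ν ∧ σ ≤ ν.map (γ • ·) ∧ ν ≪ σ := by
  have hac : ν ≪ ν.map (γ • ·) := by
    refine Measure.AbsolutelyContinuous.mk fun A hA h0 => ?_
    rw [Measure.map_apply (measurable_const_smul γ) hA] at h0
    have := h γ _ (measurable_const_smul γ hA) h0
    rwa [← Set.preimage_smul_inv, ← preimage_comp, show (γ • ·) ∘ (γ⁻¹ • ·) = (id : X → X) by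
      ext x; simp, preimage_id] at this
  refine ⟨ν.withDensity fun x => min 1 ((ν.map (γ • ·)).rnDeriv ν x), ?_, ?_, ?_⟩
  · calc _ ≤ ν.withDensity 1 := withDensity_mono (ae_of_all _ fun x => min_le_left _ _)
      _ = ν := withDensity_one
  · exact (withDensity_mono (ae_of_all _ fun x => min_le_right _ _)).trans
      (Measure.withDensity_rnDeriv_le _ _)
  · refine withDensity_absolutelyContinuous' (by fun_prop) ?_
    filter_upwards [Measure.rnDeriv_pos' hac] with x hx
    exact (lt_min one_pos hx).ne'

/-- The `ε`–`δ` form of absolute continuity, from integrability of the density `dμ/dσ`. -/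
theorem exists_pos_forall_measure_lt {Y : Type*} [MeasurableSpace Y] {μ σ : Measure Y}
    [IsFiniteMeasure μ] [SigmaFinite σ] (h : μ ≪ σ) {ε : ℝ≥0∞} (hε : ε ≠ 0) :
    ∃ δ > 0, ∀ E : Set Y, σ E < δ → μ E < ε := by
  obtain ⟨δ, hδ, H⟩ := exists_pos_setLIntegral_lt_of_measure_lt (μ := σ) (f := μ.rnDeriv σ)
    (Measure.lintegral_rnDeriv_lt_top μ σ).ne hε
  refine ⟨δ, hδ, fun E hE => ?_⟩
  rw [← Measure.setLIntegral_rnDeriv h]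
  exact H E hE

/-- The measure `m` is the sum over `γ` in a ball of the images of the minorants `σ γ` under `x ↦
(x, γ⁻¹ x)`. If a set had tiny boundary, every `γ A \ A` would be small for `σ γ`, hence for `ν`,
and `B_k · A` would hardly exceed `A`, contradicting expansion. -/
theorem exists_edgeMeasure (hℓ : IsProperLength ℓ) [IsProbabilityMeasure ν]
    (hmcp : MeasureClassPreserving Γ ν) (hae : AsymptoticallyExpanding ℓ ν) {α : ℝ}
    (hα : 0 < α) (hα2 : α ≤ 1 / 2) :
    ∃ (k : ℕ) (m : Measure (X × X)) (K c₀ : ℝ), IsFiniteMeasure m ∧ 0 < K ∧ 0 < c₀ ∧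
      m.map Prod.fst ≤ ENNReal.ofReal K • ν ∧ m.map Prod.snd ≤ ENNReal.ofReal K • ν ∧
      (∀ A C : Set X, MeasurableSet A → MeasurableSet C → ν (ballSMul ℓ k A ∩ C) = 0 →
        m (A ×ˢ C) = 0 ∧ m (C ×ˢ A) = 0) ∧
      ∀ A : Set X, MeasurableSet A → α ≤ ν.real A → ν.real A ≤ 1 - α →
        c₀ ≤ edgeBoundary m A := by
  obtain ⟨c, k, hc, H⟩ := hae
  set a : Ioc (0 : ℝ) (1 / 2) := ⟨α, hα, hα2⟩
  choose σ hσν hσm hσac using exists_common_minorant (Γ := Γ) hmcp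
  have hσfin : ∀ γ, IsFiniteMeasure (σ γ) := fun γ => isFiniteMeasure_of_le ν (hσν γ)
  set B : Finset Γ := (hℓ.finite_ball (k a)).toFinset with hB
  have hmemB : ∀ γ, γ ∈ B ↔ ℓ γ ≤ k a := fun γ => by simp [hB]
  have hBne : B.Nonempty := ⟨1, by rw [hmemB, (hℓ.eq_zero_iff 1).2 rfl]; exact Nat.zero_le _⟩
  have hN : (0 : ℝ) < B.card := by exact_mod_cast hBne.card_pos
  have hemb : ∀ γ : Γ, Measurable fun x : X => (x, γ⁻¹ • x) := fun γ =>
    measurable_id.prodMk (measurable_const_smul γ⁻¹)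
  set m : Measure (X × X) := ∑ γ ∈ B, (σ γ).map fun x => (x, γ⁻¹ • x) with hm
  have hmapply : ∀ S : Set (X × X), MeasurableSet S →
      m S = ∑ γ ∈ B, σ γ ((fun x => (x, γ⁻¹ • x)) ⁻¹' S) := fun S hS => by
    rw [hm, Measure.finsetSum_apply]
    exact Finset.sum_congr rfl fun γ _ => Measure.map_apply (hemb γ) hS
  have hσm' : ∀ (γ : Γ) (A : Set X), MeasurableSet A → σ γ ((γ⁻¹ • ·) ⁻¹' A) ≤ ν A := by
    intro γ A hA
    refine (hσm γ _).trans_eq ?_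
    rw [Measure.map_apply (measurable_const_smul γ) (measurable_const_smul γ⁻¹ hA),
      ← preimage_comp, show (γ⁻¹ • ·) ∘ (γ • ·) = (id : X → X) by ext x; simp, preimage_id]
  have hmfin : IsFiniteMeasure m := by
    refine ⟨?_⟩
    rw [hmapply _ MeasurableSet.univ]
    exact ENNReal.sum_lt_top.2 fun γ _ => measure_lt_top _ _
  have hK : ENNReal.ofReal (B.card : ℝ) = (B.card : ℝ≥0∞) := ENNReal.ofReal_natCast _
  -- Summed over the ball, errors of this size total `c α ≤ c ν(A)`, exactly what expansion forbids.
  have hε : ENNReal.ofReal (c a * α / B.card) ≠ 0 := by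
    rw [ne_eq, ENNReal.ofReal_eq_zero, not_le]
    exact div_pos (mul_pos (hc a) hα) hN
  choose δ hδ0 hδ using fun γ => exists_pos_forall_measure_lt (hσac γ) hε
  have hδmin : ∃ d : ℝ, 0 < d ∧ ∀ γ ∈ B, ENNReal.ofReal d ≤ δ γ := by
    -- The `δ γ` may be infinite; the cap `1` yields a real threshold.
    have h1 : 0 < min 1 (B.inf' hBne δ) := by
      refine lt_min one_pos ?_
      rw [Finset.lt_inf'_iff]
      exact fun γ _ => hδ0 γ
    have h2 : min 1 (B.inf' hBne δ) ≠ ∞ := ne_top_of_le_ne_top ENNReal.one_ne_top (min_le_left _ _)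
    refine ⟨(min 1 (B.inf' hBne δ)).toReal, ENNReal.toReal_pos h1.ne' h2, fun γ hγ => ?_⟩
    rw [ENNReal.ofReal_toReal h2]
    exact (min_le_right _ _).trans (Finset.inf'_le _ hγ)
  obtain ⟨d, hd0, hd⟩ := hδmin
  have hlow : ∀ A : Set X, MeasurableSet A → α ≤ ν.real A → ν.real A ≤ 1 / 2 →
      d ≤ m.real (Aᶜ ×ˢ A) := by
    intro A hA hαA hA2
    by_contra! hlt
    have hlt' : m (Aᶜ ×ˢ A) < ENNReal.ofReal d := by
      rw [ENNReal.lt_ofReal_iff_toReal_lt (measure_ne_top _ _)]; exact hlt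
    have h1 : ∀ γ ∈ B, ν.real (γ • A \ A) ≤ c a * α / B.card := by
      intro γ hγ
      have h2 : σ γ (γ • A \ A) < δ γ := by
        refine lt_of_le_of_lt ?_ (hlt'.trans_le (hd γ hγ))
        rw [hmapply _ (hA.compl.prod hA)]
        refine le_trans (measure_mono ?_) (Finset.single_le_sum
          (f := fun γ => σ γ ((fun x => (x, γ⁻¹ • x)) ⁻¹' Aᶜ ×ˢ A)) (fun _ _ => zero_le) hγ)
        rintro x ⟨hx, hxA⟩
        exact ⟨hxA, mem_smul_set_iff_inv_smul_mem.1 hx⟩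
      exact ENNReal.toReal_le_of_le_ofReal (div_nonneg (mul_nonneg (hc a).le hα.le) hN.le)
        (hδ γ _ h2).le
    have h3 : ballSMul ℓ (k a) A ⊆ A ∪ ⋃ γ ∈ B, (γ • A \ A) := by
      intro x hx
      obtain ⟨γ, hγ, y, hy, rfl⟩ := mem_ballSMul.1 hx
      by_cases h : γ • y ∈ A
      · exact Or.inl h
      · exact Or.inr (mem_biUnion ((hmemB γ).2 hγ) ⟨smul_mem_smul_set hy, h⟩)
    have h4 : ν.real (ballSMul ℓ (k a) A) ≤ ν.real A + c a * α := by
      calc _ ≤ ν.real (A ∪ ⋃ γ ∈ B, (γ • A \ A)) := measureReal_mono h3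
        _ ≤ ν.real A + ν.real (⋃ γ ∈ B, (γ • A \ A)) := measureReal_union_le _ _
        _ ≤ ν.real A + ∑ γ ∈ B, ν.real (γ • A \ A) := by
          gcongr
          exact measureReal_biUnion_finset_le _ _
        _ ≤ ν.real A + ∑ γ ∈ B, c a * α / B.card := by
          gcongr with γ hγ
          exact h1 γ hγ
        _ = _ := by
          rw [Finset.sum_const, nsmul_eq_mul, mul_div_cancel₀ _ hN.ne']
    have h5 := H a A hA (by simpa using hαA) (by simpa using hA2)
    have h6 := hc a
    nlinarith
  refine ⟨k a, m, B.card, d, hmfin, hN, hd0, ?_, ?_, ?_, ?_⟩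
  · refine Measure.le_iff.2 fun A hA => ?_
    rw [Measure.map_apply measurable_fst hA, hmapply _ (measurable_fst hA), Measure.smul_apply, hK,
      smul_eq_mul, ← nsmul_eq_mul, ← Finset.sum_const]
    exact Finset.sum_le_sum fun γ _ => hσν γ _
  · refine Measure.le_iff.2 fun A hA => ?_
    rw [Measure.map_apply measurable_snd hA, hmapply _ (measurable_snd hA), Measure.smul_apply, hK,
      smul_eq_mul, ← nsmul_eq_mul, ← Finset.sum_const]
    exact Finset.sum_le_sum fun γ _ => hσm' γ A hA
  · intro A C hA hC hAC
    rw [hmapply _ (hA.prod hC), hmapply _ (hC.prod hA)]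
    constructor
    · refine Finset.sum_eq_zero fun γ hγ => ?_
      have hmeas := (measurableSet_ballSMul hℓ (k a) hA).inter hC
      refine measure_mono_null ?_ (le_antisymm ((hσm' γ _ hmeas).trans_eq hAC) zero_le)
      rintro x ⟨hx, hx'⟩
      exact ⟨smul_mem_ballSMul hx (by rw [hℓ.inv]; exact (hmemB γ).1 hγ), hx'⟩
    · refine Finset.sum_eq_zero fun γ hγ => ?_
      refine measure_mono_null ?_ (le_antisymm ((hσν γ _).trans_eq hAC) zero_le)
      rintro x ⟨hx, hx'⟩
      refine ⟨mem_ballSMul.2 ⟨γ, (hmemB γ).1 hγ, _, hx', by simp⟩, hx⟩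
  · intro A hA h1 h2
    have n1 : 0 ≤ m.real (A ×ˢ Aᶜ) := measureReal_nonneg
    have n2 : 0 ≤ m.real (Aᶜ ×ˢ A) := measureReal_nonneg
    rw [edgeBoundary]
    -- The boundary is symmetric under complements, so a large set is replaced by its complement.
    rcases le_total (ν.real A) (1 / 2) with h | h
    · linarith [hlow A hA h1 h]
    · have h3 := hlow Aᶜ hA.compl (by rw [probReal_compl_eq_one_sub hA]; linarith)
        (by rw [probReal_compl_eq_one_sub hA]; linarith)
      rw [compl_compl] at h3
      linarith

/-- `m` is a measure on the edges in `Y` of the action's graph with a Poincaré inequality. -/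
structure IsPoincareDomain (ℓ : Γ → ℕ) (ν : Measure X) (Y : Set X) (m : Measure (X × X)) (k : ℕ)
    (K C : ℝ) : Prop where
  measurableSet : MeasurableSet Y
  finite : IsFiniteMeasure m
  map_fst_le : m.map Prod.fst ≤ ENNReal.ofReal K • ν.restrict Y
  map_snd_le : m.map Prod.snd ≤ ENNReal.ofReal K • ν.restrict Y
  null : ∀ A C : Set X, MeasurableSet A → MeasurableSet C → ν (ballSMul ℓ k A ∩ C) = 0 →
    m (A ×ˢ C) = 0 ∧ m (C ×ˢ A) = 0
  poincare : ∀ f : X → ℂ, Measurable f → MemLp f 2 (ν.restrict Y) → ∫ x in Y, f x ∂ν = 0 →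
    ∫⁻ x in Y, ‖f x‖ₑ ^ 2 ∂ν ≤ ENNReal.ofReal C * ∫⁻ z, ‖f z.1 - f z.2‖ₑ ^ 2 ∂m

/-- Restricting the edge measure to `Y ×ˢ Y` keeps both marginals inside `Y`, and the linear
expansion of `Y` feeds Cheeger's inequality. The Poincaré constant may blow up as `α` tends to `0`,
which is harmless since `α` is fixed before approximating. -/
theorem AsymptoticallyExpanding.exists_isPoincareDomain (hℓ : IsProperLength ℓ)
    [IsProbabilityMeasure ν] (hmcp : MeasureClassPreserving Γ ν)
    (hae : AsymptoticallyExpanding ℓ ν) {α : ℝ} (hα : 0 < α) (hα3 : α ≤ 1 / 3) :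
    ∃ (Y : Set X) (m : Measure (X × X)) (k : ℕ) (K C : ℝ), ν.real Yᶜ < α ∧
      IsPoincareDomain ℓ ν Y m k K C := by
  obtain ⟨k, m, K, c₀, hmfin, hK, hc₀, hfst, hsnd, hnull, hlow⟩ :=
    exists_edgeMeasure hℓ hmcp hae hα (by linarith)
  obtain ⟨Y, hY, hYα, C, hC, hexp⟩ := exists_expanding_domain ν m hα hα3 hc₀ hlow
  have hYpos : 0 < (ν.restrict Y).real univ := by
    rw [measureReal_restrict_apply_univ]
    have := probReal_compl_eq_one_sub (μ := ν) hY
    linarith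
  have hfst' : (m.restrict (Y ×ˢ Y)).map Prod.fst ≤ ENNReal.ofReal K • ν.restrict Y := by
    refine Measure.le_iff.2 fun A hA => ?_
    rw [Measure.map_apply measurable_fst hA, Measure.restrict_apply (measurable_fst hA),
      Measure.smul_apply, Measure.restrict_apply hA, ← Measure.smul_apply]
    refine le_trans ?_ (hfst (A ∩ Y))
    rw [Measure.map_apply measurable_fst (hA.inter hY)]
    exact measure_mono fun z hz => ⟨hz.1, hz.2.1⟩
  have hsnd' : (m.restrict (Y ×ˢ Y)).map Prod.snd ≤ ENNReal.ofReal K • ν.restrict Y := by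
    refine Measure.le_iff.2 fun A hA => ?_
    rw [Measure.map_apply measurable_snd hA, Measure.restrict_apply (measurable_snd hA),
      Measure.smul_apply, Measure.restrict_apply hA, ← Measure.smul_apply]
    refine le_trans ?_ (hsnd (A ∩ Y))
    rw [Measure.map_apply measurable_snd (hA.inter hY)]
    exact measure_mono fun z hz => ⟨hz.1, hz.2.2⟩
  have hexp' : ∀ A : Set X, MeasurableSet A → ν.restrict Y A * ν.restrict Y Aᶜ ≤
      ENNReal.ofReal C * (m.restrict (Y ×ˢ Y) (A ×ˢ Aᶜ) + m.restrict (Y ×ˢ Y) (Aᶜ ×ˢ A)) := by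
    intro A hA
    rw [Measure.restrict_apply hA, Measure.restrict_apply hA.compl, ← ofReal_measureReal,
      ← ofReal_measureReal, ← ofReal_measureReal, ← ofReal_measureReal,
      ← ENNReal.ofReal_mul measureReal_nonneg,
      ← ENNReal.ofReal_add measureReal_nonneg measureReal_nonneg, ← ENNReal.ofReal_mul hC.le]
    exact ENNReal.ofReal_le_ofReal (hexp A hA)
  exact ⟨Y, m.restrict (Y ×ˢ Y), k, K, _, hYα, hY, inferInstance, hfst', hsnd',
    fun A C hA hC h => ⟨le_antisymm ((Measure.restrict_le_self _).trans_eq (hnull A C hA hC h).1)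
      zero_le, le_antisymm ((Measure.restrict_le_self _).trans_eq (hnull A C hA hC h).2)
      zero_le⟩,
    fun f hf hf2 h0 => poincare_complex hC hK hYpos hfst' hsnd' hexp' hf hf2 h0⟩

end EdgeMeasure

/-! ### Approximation by operators of finite propagation -/

section Approximation

theorem isNormLimitOf_of_forall {Y : Type*} [MeasurableSpace Y] {μ : Measure Y} {Q : Op μ → Prop}
    {T : Op μ} (h : ∀ ε : ℝ, 0 < ε → ∃ S, Q S ∧ ‖S - T‖ < ε) : IsNormLimitOf Q T := by
  choose S hQ hS using fun n : ℕ => h (1 / (n + 1 : ℝ)) (by positivity)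
  exact ⟨S, hQ, squeeze_zero (fun _ => norm_nonneg _) (fun n => (hS n).le)
    tendsto_one_div_add_atTop_nhds_zero_nat⟩

theorem IsNormLimitOf.exists_norm_sub_lt {Y : Type*} [MeasurableSpace Y] {μ : Measure Y}
    {Q : Op μ → Prop} {T : Op μ} (h : IsNormLimitOf Q T) {ε : ℝ} (hε : 0 < ε) :
    ∃ S, Q S ∧ ‖S - T‖ < ε := by
  obtain ⟨S, hQ, hS⟩ := h
  obtain ⟨n, hn⟩ := (hS.eventually_lt_const hε).exists
  exact ⟨S n, hQ n, hn⟩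

theorem norm_corner_lt_of_norm_sub_lt {Y : Type*} [MeasurableSpace Y] {μ : Measure Y} {S T : Op μ}
    {ε : ℝ} (h : ‖S - T‖ < ε) {A C : Set Y} (hA : MeasurableSet A) (hC : MeasurableSet C)
    (h0 : chi μ hA ∘L S ∘L chi μ hC = 0) : ‖chi μ hA ∘L T ∘L chi μ hC‖ < ε := by
  have h1 : chi μ hA ∘L T ∘L chi μ hC = -(chi μ hA * ((S - T) * chi μ hC)) := by
    rw [sub_mul, mul_sub]
    change _ = -(chi μ hA ∘L S ∘L chi μ hC - chi μ hA ∘L T ∘L chi μ hC)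
    rw [h0, zero_sub, neg_neg]
  rw [h1, norm_neg]
  refine lt_of_le_of_lt ?_ h
  calc _ ≤ ‖chi μ hA‖ * (‖S - T‖ * ‖chi μ hC‖) :=
        (norm_mul_le _ _).trans (mul_le_mul_of_nonneg_left (norm_mul_le _ _) (norm_nonneg _))
    _ ≤ 1 * (‖S - T‖ * 1) := by
        gcongr
        · exact norm_chi_le hA
        · exact norm_chi_le hC
    _ = _ := by ring

theorem pull_comp_chi {Z W : Type*} [MeasurableSpace Z] [MeasurableSpace W] {μ : Measure Z}
    {M : Measure W} {p : W → Z} (hp : Measurable p) {K : ℝ≥0∞} (hKtop : K ≠ ∞)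
    (hK : M.map p ≤ K • μ) {Y : Set Z} (hY : MeasurableSet Y) (hpY : ∀ᵐ w ∂M, p w ∈ Y) :
    pull hp hKtop hK ∘L chi μ hY = pull hp hKtop hK := by
  refine ContinuousLinearMap.ext fun f => Lp.ext ?_
  filter_upwards [pull_chi_ae hp hKtop hK hY f, pull_ae hp hKtop hK f, hpY] with w h1 h2 h3
  rw [ContinuousLinearMap.comp_apply, h1, h2, indicator_of_mem h3]

theorem norm_sq_le_of_lintegral_le {Z W : Type*} [MeasurableSpace Z] [MeasurableSpace W]
    {μ : Measure Z} {M : Measure W} {p q : W → Z} (hp : Measurable p) (hq : Measurable q)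
    {K : ℝ≥0∞} (hKtop : K ≠ ∞) (hpK : M.map p ≤ K • μ) (hqK : M.map q ≤ K • μ) {C : ℝ} (g : L2 μ)
    (h : ∫⁻ z, ‖g z‖ₑ ^ 2 ∂μ ≤ ENNReal.ofReal C * ∫⁻ w, ‖g (p w) - g (q w)‖ₑ ^ 2 ∂M) :
    ‖g‖ ^ 2 ≤ max C 0 * ‖(pull hp hKtop hpK - pull hq hKtop hqK) g‖ ^ 2 := by
  have h1 : ∫⁻ w, ‖g (p w) - g (q w)‖ₑ ^ 2 ∂M =
      ‖(pull hp hKtop hpK - pull hq hKtop hqK) g‖ₑ ^ 2 := by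
    rw [enorm_sq_eq_lintegral]
    refine lintegral_congr_ae ?_
    filter_upwards [Lp.coeFn_sub (pull hp hKtop hpK g) (pull hq hKtop hqK g),
      pull_ae hp hKtop hpK g, pull_ae hq hKtop hqK g] with w e1 e2 e3
    rw [_root_.sub_apply, e1, Pi.sub_apply, e2, e3]
  rw [h1, ← enorm_sq_eq_lintegral, ← ofReal_norm, ← ofReal_norm,
    ← ENNReal.ofReal_pow (norm_nonneg _), ← ENNReal.ofReal_pow (norm_nonneg _)] at h
  have h2 := h.trans (mul_le_mul_left (ENNReal.ofReal_le_ofReal (le_max_left C 0)) _)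
  rwa [← ENNReal.ofReal_mul (le_max_right _ _), ENNReal.ofReal_le_ofReal_iff (by positivity)] at h2

end Approximation

/-! ### Finite-propagation approximation of the averaging projection -/

section Space

variable {Γ X : Type*} [Group Γ] [MulAction Γ X] [MeasurableSpace X] {ℓ : Γ → ℕ}
  {ν : Measure X}

theorem IsPoincareDomain.ae_fst_mem {Y : Set X} {m : Measure (X × X)} {k : ℕ} {K C : ℝ}
    (h : IsPoincareDomain ℓ ν Y m k K C) : ∀ᵐ z ∂m, z.1 ∈ Y :=
  (quasiMeasurePreserving_of_map_le measurable_fst h.map_fst_le).ae (ae_restrict_mem h.measurableSet)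

theorem IsPoincareDomain.ae_snd_mem {Y : Set X} {m : Measure (X × X)} {k : ℕ} {K C : ℝ}
    (h : IsPoincareDomain ℓ ν Y m k K C) : ∀ᵐ z ∂m, z.2 ∈ Y :=
  (quasiMeasurePreserving_of_map_le measurable_snd h.map_snd_le).ae (ae_restrict_mem h.measurableSet)

theorem smul_restrict_le (ν : Measure X) (Y : Set X) (K : ℝ≥0∞) : K • ν.restrict Y ≤ K • ν :=
  Measure.le_iff.2 fun A _ => by
    rw [Measure.smul_apply, Measure.smul_apply, smul_eq_mul, smul_eq_mul]
    gcongr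
    exact Measure.restrict_le_self

theorem dynQuasiLocal_of_isNormLimitOf {T : Op ν}
    (h : IsNormLimitOf (DynFinitePropagation ℓ) T) : DynQuasiLocal ℓ T := by
  intro ε hε
  obtain ⟨S, ⟨k, hk⟩, hS⟩ := h.exists_norm_sub_lt hε
  exact ⟨k, fun A C hA hC hAC => norm_corner_lt_of_norm_sub_lt hS hA hC (hk A C hA hC hAC)⟩

variable [IsProbabilityMeasure ν]

theorem isSelfAdjoint_averagingProjection : IsSelfAdjoint (averagingProjection ν) :=
  isSelfAdjoint_starProjection _

/-- The mean of `1_Y` is `ν(Y)`; this is the normalisation that makes the corner on `Y` a multiple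
of a projection. -/
theorem averagingProjection_mul_chi_mul {Y : Set X} (hY : MeasurableSet Y) :
    averagingProjection ν * chi ν hY * averagingProjection ν =
      (ν.real Y : ℂ) • averagingProjection ν := by
  refine ContinuousLinearMap.ext fun f => ?_
  change averagingProjection ν (chi ν hY (averagingProjection ν f)) =
    (ν.real Y : ℂ) • averagingProjection ν f
  rw [averagingProjection_apply ν f, averagingProjection_apply]
  set c := ∫ x, f x ∂ν
  have h1 : ∫ x, chi ν hY (Lp.const 2 ν c) x ∂ν = ν.real Y * c := by
    rw [integral_congr_ae (chi_apply_ae ν hY _), integral_indicator hY,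
      integral_congr_ae (ae_restrict_of_ae (Lp.coeFn_const (p := 2) (μ := ν) (c := c)))]
    simp
  rw [h1]
  refine Lp.ext ?_
  filter_upwards [Lp.coeFn_const (p := 2) (μ := ν) (c := ν.real Y * c),
    Lp.coeFn_const (p := 2) (μ := ν) (c := c),
    Lp.coeFn_smul (ν.real Y : ℂ) (Lp.const 2 ν c)] with x h1 h2 h3
  rw [h1, h3, Pi.smul_apply, h2]
  rfl

/-- The abstract approximation is applied to `D f (x, y) = f x - f y`, which depends only on `f` on
`Y` and kills constants there. -/
theorem IsPoincareDomain.exists_norm_sub_lt [MeasurableConstSMul Γ X] (hℓ : IsProperLength ℓ) {Y : Set X}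
    {m : Measure (X × X)} {k : ℕ} {K C : ℝ} (h : IsPoincareDomain ℓ ν Y m k K C)
    (hY0 : ν.real Y ≠ 0) {ε : ℝ} (hε : 0 < ε) :
    ∃ S : Op ν, DynFinitePropagation ℓ S ∧
      ‖S - chi ν h.measurableSet * averagingProjection ν * chi ν h.measurableSet‖ < ε := by
  have hY := h.measurableSet
  have hp := h.map_fst_le.trans (smul_restrict_le ν Y _)
  have hq := h.map_snd_le.trans (smul_restrict_le ν Y _)
  have hK : ENNReal.ofReal K ≠ ∞ := ENNReal.ofReal_ne_top
  refine exists_dynFinitePropagation_norm_sub_lt hℓ isSelfAdjoint_averagingProjection hY hY0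
    (averagingProjection_mul_chi_mul hY) (pull measurable_fst hK hp - pull measurable_snd hK hq)
    ?_ ?_ (max C 0) ?_ (dynFinitePropagation_adjoint_comp_pull_sub hℓ _ _ _ _ _ (k := k) ?_) hε
  · rw [ContinuousLinearMap.sub_comp, pull_comp_chi _ _ _ _ h.ae_fst_mem,
      pull_comp_chi _ _ _ _ h.ae_snd_mem]
  · refine ContinuousLinearMap.ext fun f => ?_
    rw [ContinuousLinearMap.sub_comp, _root_.sub_apply, _root_.zero_apply, sub_eq_zero]
    simp only [ContinuousLinearMap.comp_apply]
    rw [averagingProjection_apply]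
    refine Lp.ext ?_
    have hc := Lp.coeFn_const (p := 2) (μ := ν) (c := ∫ x, f x ∂ν)
    filter_upwards [pull_chi_ae measurable_fst hK hp hY (Lp.const 2 ν (∫ x, f x ∂ν)),
      pull_chi_ae measurable_snd hK hq hY (Lp.const 2 ν (∫ x, f x ∂ν)), h.ae_fst_mem, h.ae_snd_mem,
      (quasiMeasurePreserving_of_map_le measurable_fst hp).ae hc,
      (quasiMeasurePreserving_of_map_le measurable_snd hq).ae hc] with z e1 e2 e3 e4 e5 e6
    rw [e1, e2, indicator_of_mem e3, indicator_of_mem e4, e5, e6]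
    rfl
  · intro g hg hPg
    refine norm_sq_le_of_lintegral_le measurable_fst measurable_snd hK hp hq g ?_
    have hgY : ∀ᵐ x ∂ν, g x = Y.indicator g x := by
      have := chi_apply_ae ν hY g
      rwa [hg] at this
    have hint : ∫ x in Y, g x ∂ν = 0 := by
      rw [← integral_indicator hY, ← integral_congr_ae hgY]
      have h1 : ∀ᵐ x ∂ν, (0 : L2 ν) x = ∫ x, g x ∂ν := by
        rw [← hPg, averagingProjection_apply]
        exact Lp.coeFn_const _ _ _
      obtain ⟨x, hx, hx'⟩ := (h1.and (Lp.coeFn_zero ℂ 2 ν)).exists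
      rw [← hx, hx']
      rfl
    have hr : ∫⁻ x, ‖g x‖ₑ ^ 2 ∂ν = ∫⁻ x in Y, ‖g x‖ₑ ^ 2 ∂ν := by
      rw [← lintegral_indicator hY]
      refine lintegral_congr_ae ?_
      filter_upwards [hgY] with x hx
      by_cases hxY : x ∈ Y
      · rw [indicator_of_mem hxY]
      · rw [indicator_of_notMem hxY, hx, indicator_of_notMem hxY]
        simp
    rw [hr]
    exact h.poincare g (Lp.stronglyMeasurable g).measurable ((Lp.memLp g).restrict Y) hint
  · exact fun A C hA hC hAC => ⟨(h.null A C hA hC hAC).1, by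
      have := (h.null A C hA hC hAC).2
      rwa [inter_comm]⟩

theorem AsymptoticallyExpanding.isNormLimitOf_averagingProjection [MeasurableConstSMul Γ X] (hℓ : IsProperLength ℓ)
    (hmcp : MeasureClassPreserving Γ ν) (hae : AsymptoticallyExpanding ℓ ν) :
    IsNormLimitOf (DynFinitePropagation ℓ) (averagingProjection ν) := by
  refine isNormLimitOf_of_forall fun ε hε => ?_
  -- A complement of measure below `(ε / 4)²` makes the corner on `Y` differ from the projection by
  -- at most `2 · ε / 4`; approximating that corner takes the other `ε / 2`. The cap `1 / 3` also
  -- keeps `ν(Y)` positive.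
  obtain ⟨Y, m, k, K, C, hYα, h⟩ := hae.exists_isPoincareDomain hℓ hmcp
    (α := min ((ε / 4) ^ 2) (1 / 3)) (by positivity) (min_le_right _ _)
  have hY := h.measurableSet
  have hY1 := probReal_compl_eq_one_sub (μ := ν) hY
  have hY2 : ν.real Yᶜ < 1 / 3 := hYα.trans_le (min_le_right _ _)
  have hb : ‖chi ν hY.compl * averagingProjection ν‖ ≤ ε / 4 := by
    have h1 := norm_chi_averagingProjection_chi ν hY.compl MeasurableSet.univ
    rw [chi_univ, probReal_univ, Real.sqrt_one, mul_one] at h1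
    refine h1.le.trans ?_
    rw [Real.sqrt_le_left (by positivity)]
    exact hYα.le.trans (min_le_left _ _)
  obtain ⟨S, hS, hSε⟩ := h.exists_norm_sub_lt hℓ (by linarith) (half_pos hε)
  refine ⟨S, hS, ?_⟩
  calc _ ≤ _ := norm_sub_le_norm_sub_add_norm_sub S
        (chi ν hY * averagingProjection ν * chi ν hY) _
    _ < ε / 2 + 2 * (ε / 4) :=
        add_lt_add_of_lt_of_le hSε
          (norm_chi_mul_mul_chi_sub_le isSelfAdjoint_averagingProjection hY hb)
    _ = ε := by ring

theorem quasiLocal_of_isNormLimitOf {Y : Type*} [MeasurableSpace Y] {μ : Measure Y}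
    {δ : Y → Y → ℝ} {T : Op μ} (h : IsNormLimitOf (FinitePropagation δ) T) : QuasiLocal δ T := by
  intro ε hε
  obtain ⟨S, ⟨R, hR, hk⟩, hS⟩ := h.exists_norm_sub_lt hε
  exact ⟨R, hR, fun A C hA hC hAC => norm_corner_lt_of_norm_sub_lt hS hA hC (hk A C hA hC hAC)⟩

end Space

/-! ### The same approximation, fibre by fibre, on the cone -/

section ConeApproximation

variable {Γ X : Type*} [Group Γ] [MulAction Γ X] {ℓ : Γ → ℕ}

/-- The action on the cone through the first coordinate. -/
@[reducible]
def coneAction (Γ X : Type*) [Group Γ] [MulAction Γ X] : MulAction Γ (Cone X) where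
  smul γ p := (γ • p.1, p.2)
  one_smul p := Prod.ext (one_smul Γ p.1) rfl
  mul_smul γ γ' p := Prod.ext (mul_smul γ γ' p.1) rfl

attribute [local instance] coneAction

theorem cone_smul_mk (γ : Γ) (x : X) (t : Ici (1 : ℝ)) : γ • (x, t) = (γ • x, t) := rfl

theorem ballSMul_cone_fiber (k : ℕ) (A : Set (Cone X)) (t : Ici (1 : ℝ)) :
    (fun x : X => (x, t)) ⁻¹' ballSMul ℓ k A = ballSMul ℓ k ((fun x : X => (x, t)) ⁻¹' A) := by
  ext x
  simp only [mem_preimage, mem_ballSMul]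
  constructor
  · rintro ⟨γ, hγ, ⟨a, s⟩, ha, e⟩
    rw [cone_smul_mk, Prod.mk.injEq] at e
    obtain ⟨rfl, rfl⟩ := e
    exact ⟨γ, hγ, a, ha, rfl⟩
  · rintro ⟨γ, hγ, a, ha, rfl⟩
    exact ⟨γ, hγ, (a, t), ha, rfl⟩

/-- Acting on the first coordinate, elements of length at most `k` displace points of the cone by at
most `k`. The algebra of dynamical propagation can therefore be used on the cone itself. -/
theorem finitePropagation_of_dynFinitePropagation {X : Type*} [MetricSpace X] [MulAction Γ X]
    [MeasurableSpace X] (hℓ : IsProperLength ℓ) {μ : Measure (Cone X)} {T : Op μ}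
    (h : DynFinitePropagation ℓ T) : FinitePropagation (coneDist ℓ) T := by
  obtain ⟨k, hk⟩ := h
  refine ⟨k + 1, by positivity, fun A C hA hC hAC => hk A C hA hC ?_⟩
  convert measure_empty (μ := μ)
  rw [eq_empty_iff_forall_notMem]
  rintro _ ⟨hx, hxC⟩
  obtain ⟨γ, hγ, ⟨a, t⟩, ha, rfl⟩ := mem_ballSMul.1 hx
  have h1 := lt_of_lt_setDist hAC ha hxC
  have h2 := coneDist_smul_le hℓ γ a t
  have h3 : (ℓ γ : ℝ) ≤ k := by exact_mod_cast hγ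
  rw [cone_smul_mk] at h1
  linarith

variable [MeasurableSpace X] [MeasurableConstSMul Γ X]

theorem measurableConstSMul_cone : MeasurableConstSMul Γ (Cone X) :=
  ⟨fun γ => ((measurable_const_smul γ).comp measurable_fst).prodMk measurable_snd⟩

attribute [local instance] measurableConstSMul_cone

variable {ν : Measure X}

theorem map_prod_lebesgueRay_le {m : Measure (X × X)} [SFinite m] [SFinite ν] {π : X × X → X}
    (hπ : Measurable π) {K : ℝ≥0∞} (h : m.map π ≤ K • ν) :
    (m.prod lebesgueRay).map (fun w => (π w.1, w.2)) ≤ K • coneMeasure ν := by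
  have hmeas : Measurable fun w : (X × X) × Ici (1 : ℝ) => (π w.1, w.2) :=
    (hπ.comp measurable_fst).prodMk measurable_snd
  refine Measure.le_iff.2 fun S hS => ?_
  rw [Measure.map_apply hmeas hS, Measure.prod_apply_symm (hmeas hS), Measure.smul_apply,
    coneMeasure, Measure.prod_apply_symm hS, smul_eq_mul,
    ← lintegral_const_mul _ (measurable_measure_prodMk_right hS)]
  refine lintegral_mono fun t => ?_
  have hSt : MeasurableSet ((fun x : X => (x, t)) ⁻¹' S) := measurable_prodMk_right hS
  have := h ((fun x : X => (x, t)) ⁻¹' S)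
  rwa [Measure.map_apply hπ hSt, Measure.smul_apply, smul_eq_mul] at this

variable [IsProbabilityMeasure ν]

theorem isSelfAdjoint_drutuNowak : IsSelfAdjoint (drutuNowak ν) :=
  isSelfAdjoint_starProjection _

theorem drutuNowak_mul_chi_mul {Y : Set X} (hY : MeasurableSet Y) :
    drutuNowak ν * chi (coneMeasure ν) (measurable_fst hY) * drutuNowak ν =
      (ν.real Y : ℂ) • drutuNowak ν := by
  refine ContinuousLinearMap.ext fun F => Lp.ext ?_
  change drutuNowak ν (chi (coneMeasure ν) (measurable_fst hY) (drutuNowak ν F)) =ᵐ[coneMeasure ν]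
    ((ν.real Y : ℂ) • drutuNowak ν F : L2 (coneMeasure ν))
  have h1 : chi (coneMeasure ν) (measurable_fst hY) (drutuNowak ν F) =ᵐ[coneMeasure ν]
      (Prod.fst ⁻¹' Y).indicator fun p => ∫ x, F (x, p.2) ∂ν := by
    filter_upwards [chi_apply_ae (coneMeasure ν) (measurable_fst hY) (drutuNowak ν F),
      drutuNowak_ae ν F] with p e1 e2
    rw [e1]
    by_cases hp : p ∈ (Prod.fst ⁻¹' Y : Set (Cone X))
    · rw [indicator_of_mem hp, indicator_of_mem hp, e2]
    · rw [indicator_of_notMem hp, indicator_of_notMem hp]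
  filter_upwards [drutuNowak_ae_of_ae_eq ν _ h1, drutuNowak_ae ν F,
    Lp.coeFn_smul (ν.real Y : ℂ) (drutuNowak ν F)] with p e1 e2 e3
  rw [e1, e3, Pi.smul_apply, e2]
  have e4 : (fun x => (Prod.fst ⁻¹' Y : Set (Cone X)).indicator
      (fun p => ∫ x, F (x, p.2) ∂ν) (x, p.2)) = Y.indicator fun _ => ∫ x, F (x, p.2) ∂ν := by
    ext x
    by_cases hx : x ∈ Y <;> simp [hx]
  rw [e4, integral_indicator_const _ hY]
  simp

/-- The edge measure `m × λ` joins points on a common level only, so the Poincaré inequality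
integrates over the levels with one constant. -/
theorem IsPoincareDomain.exists_norm_sub_lt_cone (hℓ : IsProperLength ℓ) {Y : Set X}
    {m : Measure (X × X)} {k : ℕ} {K C : ℝ} (h : IsPoincareDomain ℓ ν Y m k K C)
    (hY0 : ν.real Y ≠ 0) {ε : ℝ} (hε : 0 < ε) :
    ∃ S : Op (coneMeasure ν), DynFinitePropagation ℓ S ∧
      ‖S - chi _ (measurable_fst h.measurableSet) * drutuNowak ν *
        chi _ (measurable_fst h.measurableSet)‖ < ε := by
  have hY := h.measurableSet
  have hYc : MeasurableSet (Prod.fst ⁻¹' Y : Set (Cone X)) := measurable_fst hY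
  have hmfin := h.finite
  have hpm : Measurable fun w : (X × X) × Ici (1 : ℝ) => (w.1.1, w.2) := by fun_prop
  have hqm : Measurable fun w : (X × X) × Ici (1 : ℝ) => (w.1.2, w.2) := by fun_prop
  have hp := map_prod_lebesgueRay_le measurable_fst (h.map_fst_le.trans (smul_restrict_le ν Y _))
  have hq := map_prod_lebesgueRay_le measurable_snd (h.map_snd_le.trans (smul_restrict_le ν Y _))
  have hK : ENNReal.ofReal K ≠ ∞ := ENNReal.ofReal_ne_top
  have hfst : ∀ᵐ w ∂m.prod lebesgueRay, (w.1.1, w.2) ∈ (Prod.fst ⁻¹' Y : Set (Cone X)) :=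
    Measure.quasiMeasurePreserving_fst.ae h.ae_fst_mem
  have hsnd : ∀ᵐ w ∂m.prod lebesgueRay, (w.1.2, w.2) ∈ (Prod.fst ⁻¹' Y : Set (Cone X)) :=
    Measure.quasiMeasurePreserving_fst.ae h.ae_snd_mem
  refine exists_dynFinitePropagation_norm_sub_lt hℓ isSelfAdjoint_drutuNowak hYc hY0
    (drutuNowak_mul_chi_mul hY) (pull hpm hK hp - pull hqm hK hq)
    ?_ ?_ (max C 0) ?_ (dynFinitePropagation_adjoint_comp_pull_sub hℓ _ _ _ _ _ (k := k) ?_) hε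
  · rw [ContinuousLinearMap.sub_comp, pull_comp_chi _ _ _ _ hfst, pull_comp_chi _ _ _ _ hsnd]
  · refine ContinuousLinearMap.ext fun f => ?_
    rw [ContinuousLinearMap.sub_comp, _root_.sub_apply, _root_.zero_apply, sub_eq_zero]
    simp only [ContinuousLinearMap.comp_apply]
    refine Lp.ext ?_
    have hc := drutuNowak_ae ν f
    filter_upwards [pull_chi_ae hpm hK hp hYc (drutuNowak ν f),
      pull_chi_ae hqm hK hq hYc (drutuNowak ν f), hfst, hsnd,
      (quasiMeasurePreserving_of_map_le hpm hp).ae hc,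
      (quasiMeasurePreserving_of_map_le hqm hq).ae hc] with z e1 e2 e3 e4 e5 e6
    rw [e1, e2, indicator_of_mem e3, indicator_of_mem e4, e5, e6]
  · intro g hg hPg
    refine norm_sq_le_of_lintegral_le hpm hqm hK hp hq g ?_
    have hgm : Measurable g := (Lp.stronglyMeasurable g).measurable
    have hgY : ∀ᵐ p ∂coneMeasure ν, g p = (Prod.fst ⁻¹' Y).indicator g p := by
      have := chi_apply_ae (coneMeasure ν) hYc g
      rwa [hg] at this
    have hPg' : ∀ᵐ p ∂coneMeasure ν, ∫ x, g (x, p.2) ∂ν = 0 := by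
      have := drutuNowak_ae ν g
      rw [hPg] at this
      filter_upwards [this, Lp.coeFn_zero ℂ 2 (coneMeasure ν)] with p e1 e2
      rw [← e1, e2]
      rfl
    have hm2 : Measurable fun w : (X × X) × Ici (1 : ℝ) =>
        ‖g (w.1.1, w.2) - g (w.1.2, w.2)‖ₑ ^ 2 :=
      (((hgm.comp hpm).sub (hgm.comp hqm)).enorm).pow_const 2
    rw [lintegral_coneMeasure ν (hgm.enorm.pow_const 2).aemeasurable,
      lintegral_prod_symm _ hm2.aemeasurable,
      ← lintegral_const_mul' _ _ ENNReal.ofReal_ne_top]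
    refine lintegral_mono_ae ?_
    -- For almost every `t` the slice of `g` is square-integrable, supported in `Y` and of mean
    -- zero.
    filter_upwards [ae_fiber ν hgY, ae_fiber ν hPg', ae_fiber_memLp ν g] with t e1 e2 e3
    have e1' : ∀ᵐ x ∂ν, g (x, t) = Y.indicator (fun x => g (x, t)) x := by
      filter_upwards [e1] with x hx
      rw [hx]
      by_cases hxY : x ∈ Y <;> simp [hxY]
    have hint : ∫ x in Y, g (x, t) ∂ν = 0 := by
      rw [← integral_indicator hY, ← integral_congr_ae e1']
      exact e2.exists.choose_spec
    have hr : ∫⁻ x, ‖g (x, t)‖ₑ ^ 2 ∂ν = ∫⁻ x in Y, ‖g (x, t)‖ₑ ^ 2 ∂ν := by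
      rw [← lintegral_indicator hY]
      refine lintegral_congr_ae ?_
      filter_upwards [e1'] with x hx
      by_cases hxY : x ∈ Y
      · rw [indicator_of_mem hxY]
      · rw [indicator_of_notMem hxY, hx, indicator_of_notMem hxY]
        simp
    rw [hr]
    exact h.poincare (fun x => g (x, t)) (hgm.comp measurable_prodMk_right) (e3.restrict Y) hint
  · intro A C hA hC hAC
    -- Neighbourhoods commute with taking fibres, so Fubini reduces nullity on the cone to that of
    -- almost every fibre.
    have hfib : ∀ᵐ t ∂lebesgueRay, ν (ballSMul ℓ k ((fun x : X => (x, t)) ⁻¹' A) ∩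
        (fun x : X => (x, t)) ⁻¹' C) = 0 := by
      filter_upwards [ae_fiber ν (measure_eq_zero_iff_ae_notMem.1 hAC)] with t ht
      rw [← ballSMul_cone_fiber]
      exact measure_eq_zero_iff_ae_notMem.2 ht
    constructor
    · rw [Measure.prod_apply_symm ((hpm hA).inter (hqm hC))]
      refine lintegral_eq_zero_of_ae_eq_zero ?_
      filter_upwards [hfib] with t ht
      exact (h.null _ _ (measurable_prodMk_right hA) (measurable_prodMk_right hC) ht).1
    · rw [Measure.prod_apply_symm ((hqm hA).inter (hpm hC))]
      refine lintegral_eq_zero_of_ae_eq_zero ?_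
      filter_upwards [hfib] with t ht
      refine measure_mono_null ?_
        (h.null _ _ (measurable_prodMk_right hA) (measurable_prodMk_right hC) ht).2
      exact fun z hz => ⟨hz.2, hz.1⟩

theorem AsymptoticallyExpanding.isNormLimitOf_drutuNowak {X : Type*} [MetricSpace X]
    [MulAction Γ X] [MeasurableSpace X] [MeasurableConstSMul Γ X] {ν : Measure X}
    [IsProbabilityMeasure ν] (hℓ : IsProperLength ℓ) (hmcp : MeasureClassPreserving Γ ν)
    (hae : AsymptoticallyExpanding ℓ ν) :
    IsNormLimitOf (FinitePropagation (coneDist ℓ)) (drutuNowak ν) := by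
  refine isNormLimitOf_of_forall fun ε hε => ?_
  obtain ⟨Y, m, k, K, C, hYα, h⟩ := hae.exists_isPoincareDomain hℓ hmcp
    (α := min ((ε / 4) ^ 2) (1 / 3)) (by positivity) (min_le_right _ _)
  have hY := h.measurableSet
  have hYc : MeasurableSet (Prod.fst ⁻¹' Y : Set (Cone X)) := measurable_fst hY
  have hY1 := probReal_compl_eq_one_sub (μ := ν) hY
  have hY2 : ν.real Yᶜ < 1 / 3 := hYα.trans_le (min_le_right _ _)
  have hb : ‖chi (coneMeasure ν) hYc.compl * drutuNowak ν‖ ≤ ε / 4 := by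
    have h1 := norm_chi_drutuNowak_chi_le ν hYc.compl MeasurableSet.univ
      (b := ε / 4) (by positivity) fun t => by
        rw [preimage_univ, probReal_univ, mul_one]
        exact hYα.le.trans (min_le_left _ _)
    rwa [chi_univ] at h1
  obtain ⟨S, hS, hSε⟩ := h.exists_norm_sub_lt_cone hℓ (by linarith) (half_pos hε)
  refine ⟨S, finitePropagation_of_dynFinitePropagation hℓ hS, ?_⟩
  calc _ ≤ _ := norm_sub_le_norm_sub_add_norm_sub S
        (chi (coneMeasure ν) hYc * drutuNowak ν * chi _ hYc) _
    _ < ε / 2 + 2 * (ε / 4) :=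
        add_lt_add_of_lt_of_le hSε (norm_chi_mul_mul_chi_sub_le isSelfAdjoint_drutuNowak hYc hb)
    _ = ε := by ring

end ConeApproximation

end AsympExp

open AsympExp in
theorem theoremE {Γ : Type*} [Group Γ] [Countable Γ] (ℓ : Γ → ℕ) (hℓ : IsProperLength ℓ)
    {X : Type*} [MetricSpace X] [MeasurableSpace X] [BorelSpace X]
    (hdiam : ∀ x y : X, dist x y ≤ 2)
    [MulAction Γ X] [ContinuousConstSMul Γ X]
    (ν : Measure X) [IsProbabilityMeasure ν] :
    (ν.Regular →
      [AsymptoticallyExpanding ℓ ν,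
        DynQuasiLocal ℓ (averagingProjection ν),
        QuasiLocal (coneDist ℓ) (drutuNowak ν),
        UniformlyQuasiLocal ℓ (fun _ => averagingProjection ν)].TFAE) ∧
    (MeasureClassPreserving Γ ν →
      [AsymptoticallyExpanding ℓ ν,
        IsNormLimitOf (DynFinitePropagation ℓ) (averagingProjection ν),
        IsNormLimitOf (FinitePropagation (coneDist ℓ)) (drutuNowak ν)].TFAE) := by
  have h12 : AsymptoticallyExpanding ℓ ν → DynQuasiLocal ℓ (averagingProjection ν) :=
    fun h => h.dynQuasiLocal hℓ
  have h23 : DynQuasiLocal ℓ (averagingProjection ν) → QuasiLocal (coneDist ℓ) (drutuNowak ν) :=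
    quasiLocal_drutuNowak_of_dynQuasiLocal hℓ
  have h34 : QuasiLocal (coneDist ℓ) (drutuNowak ν) →
      UniformlyQuasiLocal ℓ (fun _ => averagingProjection ν) :=
    uniformlyQuasiLocal_of_quasiLocal_drutuNowak hℓ
  have h41 : UniformlyQuasiLocal ℓ (fun _ => averagingProjection ν) →
      AsymptoticallyExpanding ℓ ν := asymptoticallyExpanding_of_uniformlyQuasiLocal hℓ
  refine ⟨fun _ => ?_, fun hmcp => ?_⟩
  · tfae_have 1 → 2 := h12
    tfae_have 2 → 3 := h23
    tfae_have 3 → 4 := h34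
    tfae_have 4 → 1 := h41
    tfae_finish
  · tfae_have 1 → 2 := fun h => h.isNormLimitOf_averagingProjection hℓ hmcp
    tfae_have 1 → 3 := fun h => h.isNormLimitOf_drutuNowak hℓ hmcp
    -- Norm limits of finite propagation are quasi-local, because cutting to a corner does not
    -- increase the norm; the cycle of Part I then returns expansion.
    tfae_have 2 → 1 := fun h => h41 (h34 (h23 (dynQuasiLocal_of_isNormLimitOf h)))
    tfae_have 3 → 1 := fun h => h41 (h34 (quasiLocal_of_isNormLimitOf h))
    tfae_finish
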